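/- Let $c>0$ and $\alpha,\beta>-1$ be real, $I=[-1,1]$, $\omega_{\alpha,\beta}(x)=(1-x)^{\alpha}(1+x)^{\beta}$, and for $\varphi\in C^2(I)$ let $$\mathcal L_c^{(\alpha,\beta)}\varphi(x)=(1-x^2)\varphi''(x)+\big((\beta-\alpha)-(\alpha+\beta+2)x\big)\varphi'(x)-c^2x^2\varphi(x).$$ An eigenvalue of $-\mathcal L_c^{(\alpha,\beta)}$ is a real $\chi$ for which $-\mathcal L_c^{(\alpha,\beta)}\varphi=\chi\varphi$ on $I$ for some real-valued $\varphi\in C^2(I)$, $\varphi\not\equiv0$ (an eigenfunction). For $n\ge 0$, an $n$-th eigenfunction is one whose eigenvalue has exactly $n$ eigenvalues below it; it is normalized if $\int_{-1}^1\varphi^2\,\omega_{\alpha,\beta}\,dx=1$. For every $n\ge0$ there is a normalized $n$-th eigenfunction $\psi_{n,c}^{(\alpha,\beta)}$ of $-\mathcal L_c^{(\alpha,\beta)}$; its eigenvalue $\chi_n(c)$ is unique, it is unique up to sign on $I$, it does not vanish at $1$, and it extends to a real-analytic function on $\mathbb R$, denoted by the same symbol. Moreover: $(P_1)$ For any choice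 of signs, $\{\psi_{n,c}^{(\alpha,\beta)} : n\ge0\}$ is an orthonormal basis of $L^2(I,\omega_{\alpha,\beta})$ (over $\mathbb R$ as well as over $\mathbb C$). $(P_2)$ For every $n\ge 0$, $\psi_{n,c}^{(\alpha,\beta)}$ and $\psi_{n,c}^{(\beta,\alpha)}$ (the normalized $n$-th eigenfunction of $-\mathcal L_c^{(\beta,\alpha)}$) have the same eigenvalue $\chi_n(c)$, and if the signs are chosen so that $\psi_{n,c}^{(\alpha,\beta)}(1)>0$ and $\psi_{n,c}^{(\beta,\alpha)}(1)>0$, then $$\psi_{n,c}^{(\alpha,\beta)}(-x)=(-1)^n\,\psi_{n,c}^{(\beta,\alpha)}(x),\qquad x\in\mathbb R .$$ -/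

import Mathlib

open MeasureTheory Set

noncomputable section

namespace PerturbedJacobi

/-- The interval `I = [-1, 1]`. -/
def I : Set ℝ := Icc (-1) 1

/-- The Jacobi weight `(1 - x)^α (1 + x)^β`. -/
def weight (α β x : ℝ) : ℝ := (1 - x) ^ α * (1 + x) ^ β

/-- The measure `(1 - x)^α (1 + x)^β dx` on `I`. -/
def weightMeasure (α β : ℝ) : Measure ℝ :=
  (volume.restrict I).withDensity fun x => ENNReal.ofReal (weight α β x)

/-- The perturbed Jacobi operator
`L f = (1 - x²) f'' + ((β - α) - (α + β + 2) x) f' - c² x² f` on `C²(I)`;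
the derivatives are one-sided at the endpoints of `I`. -/
def op (c α β : ℝ) (f : ℝ → ℝ) (x : ℝ) : ℝ :=
  (1 - x ^ 2) * derivWithin (derivWithin f I) I x
    + ((β - α) - (α + β + 2) * x) * derivWithin f I x - c ^ 2 * x ^ 2 * f x

/-- `f ∈ C²(I)` does not vanish identically on `I` and satisfies `-L f = χ f` on `I`.
Only the values of `f` on `I` matter. -/
structure IsEigenpair (c α β χ : ℝ) (f : ℝ → ℝ) : Prop where
  contDiffOn : ContDiffOn ℝ 2 f I
  ne_zero : ∃ x ∈ I, f x ≠ 0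
  eigen : ∀ x ∈ I, -op c α β f x = χ * f x

/-- `χ` is an eigenvalue of `-L`. -/
def IsEigenvalue (c α β χ : ℝ) : Prop := ∃ f : ℝ → ℝ, IsEigenpair c α β χ f

/-- `f` is an `n`-th normalized eigenfunction, with eigenvalue `χ`: exactly `n` eigenvalues of `-L`
are smaller than `χ` (so `n = 0` is the lowest one), and `f` has norm one in `L²(I, weight)`. -/
structure IsNthEigenfunction (c α β : ℝ) (n : ℕ) (χ : ℝ) (f : ℝ → ℝ) : Prop where
  eigenpair : IsEigenpair c α β χ f
  index : {χ' : ℝ | χ' < χ ∧ IsEigenvalue c α β χ'}.encard = n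
  normalized : ∫ x in (-1 : ℝ)..1, f x ^ 2 * weight α β x = 1

end PerturbedJacobi

end

/-!
The eigenvalue problem is solved by perturbation from the Jacobi polynomials and by oscillation
theory. Throughout, `ω` is the weight `(1 - x)^α (1 + x)^β`, and the Jacobi polynomials `P_n`, the
eigenfunctions for `c = 0` with eigenvalues `λ_n = n (n + α + β + 1)`, are the basis in which
everything is expanded. The operator `L` is symmetric on `C²(I)` without boundary conditions because
`(1 - x²) ω` vanishes at the endpoints (`integral_op_mul`).

*Completeness.* In the orthonormal basis of Jacobi polynomials, `-L` is the diagonal operator with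
entries `λ_n → ∞` plus the bounded operator `c² x²`, so it has a compact symmetric resolvent and its
weak eigenvectors are complete (`eq_zero_of_forall_inner_weak_eigenvector`).

*Regularity.* Multiplication by `x²` is a band matrix, so the Jacobi coefficients of a weak
eigenvector satisfy a recurrence with diagonal `λ_n - χ → ∞` and decay faster than any geometric
sequence (`exists_forall_abs_le_mul_pow`), whereas the normalized Jacobi polynomials grow at most
geometrically on compact subsets of `ℂ` (`norm_aeval_jacobiPoly_le`, `le_integral_jacobiPoly_sq`).
Hence the Jacobi series of a weak eigenvector converges to an entire function, which solves the
equation on `I` (`exists_analytic_eigenfunction_of_weak`). Applied to classical eigenfunctions, this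
shows that all of them are restrictions of analytic functions; the indicial equation
(`eq_zero_of_analytic_of_vanish`) then shows that they do not vanish at `±1`, have simple zeros, and
that the eigenspaces are one-dimensional.

*Counting.* The min-max principle (`card_le_of_eigenpairs`) shows that there are finitely many
eigenvalues below any bound, so that they are enumerated by the number of eigenvalues below, and that
the `n`-th one is at most `λ_n + c²`.

*Reflection.* The map `f ↦ f (-x)` exchanges `α` and `β`, so it maps `n`-th eigenfunctions to `n`-th
eigenfunctions, and only the sign has to be determined. It is `(-1)ⁿ` because the `n`-th
eigenfunction has exactly `n` zeros in `(-1, 1)`, all simple. By Sturm's comparison theorem the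
number of zeros increases strictly with `n`, and since the `n`-th eigenvalue is less than `λ_{n+1}`
for large `n`, it is less than the number of zeros of `P_{n+1}`, which is at most `n + 1`
(`IsNthEigenfunction.zeroCount_eq`).
-/

namespace PerturbedJacobi

/-! ### The weighted measure -/

lemma weight_nonneg {α β x : ℝ} (hx : x ∈ I) : 0 ≤ weight α β x :=
  mul_nonneg (Real.rpow_nonneg (by linarith [hx.2]) _) (Real.rpow_nonneg (by linarith [hx.1]) _)

lemma weight_pos {α β x : ℝ} (hx : x ∈ Ioo (-1 : ℝ) 1) : 0 < weight α β x :=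
  mul_pos (Real.rpow_pos_of_pos (by linarith [hx.2]) _)
    (Real.rpow_pos_of_pos (by linarith [hx.1]) _)

lemma weight_neg (α β x : ℝ) : weight α β (-x) = weight β α x := by
  simp only [weight, sub_neg_eq_add, ← sub_eq_add_neg, mul_comm]

lemma measurable_weight (α β : ℝ) : Measurable (weight α β) := by
  unfold weight
  fun_prop

lemma uniqueDiffOn_I : UniqueDiffOn ℝ I := uniqueDiffOn_Icc (by norm_num)

lemma isCompact_I : IsCompact I := isCompact_Icc

lemma measurableSet_I : MeasurableSet I := measurableSet_Icc

lemma Ioo_subset_I : Ioo (-1 : ℝ) 1 ⊆ I := Ioo_subset_Icc_self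

lemma neg_mem_I {x : ℝ} (hx : x ∈ I) : -x ∈ I := ⟨by linarith [hx.2], by linarith [hx.1]⟩

lemma intervalIntegrable_weight {α β : ℝ} (hα : -1 < α) (hβ : -1 < β) :
    IntervalIntegrable (weight α β) volume (-1) 1 := by
  have h1 : IntervalIntegrable (weight α β) volume (-1) 0 := by
    unfold weight
    have h : IntervalIntegrable (fun x : ℝ => (1 + x) ^ β) volume (-1) 0 := by
      have := (intervalIntegral.intervalIntegrable_rpow' (a := 0) (b := 1) hβ).comp_add_left 1
      simpa using this
    refine h.continuousOn_mul ?_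
    refine ContinuousOn.rpow_const (by fun_prop) fun x hx => Or.inl ?_
    rw [uIcc_of_le (by norm_num)] at hx
    linarith [hx.2]
  have h2 : IntervalIntegrable (weight α β) volume 0 1 := by
    unfold weight
    have h : IntervalIntegrable (fun x : ℝ => (1 - x) ^ α) volume 0 1 := by
      have := (intervalIntegral.intervalIntegrable_rpow' (a := 1) (b := 0) hα).comp_sub_left 1
      simpa using this
    refine h.mul_continuousOn ?_
    refine ContinuousOn.rpow_const (by fun_prop) fun x hx => Or.inl ?_
    rw [uIcc_of_le (by norm_num)] at hx
    linarith [hx.1]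
  exact h1.trans h2

lemma isFiniteMeasure_weightMeasure {α β : ℝ} (hα : -1 < α) (hβ : -1 < β) :
    IsFiniteMeasure (weightMeasure α β) := by
  have h := intervalIntegrable_weight hα hβ
  rw [intervalIntegrable_iff_integrableOn_Icc_of_le (by norm_num)] at h
  exact isFiniteMeasure_withDensity_ofReal h.2

lemma ae_mem_I (α β : ℝ) : ∀ᵐ x ∂(weightMeasure α β), x ∈ I :=
  (withDensity_absolutelyContinuous _ _).ae_le (ae_restrict_mem measurableSet_I)

lemma integral_weightMeasure {E : Type*} [NormedAddCommGroup E] [NormedSpace ℝ E]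
    (α β : ℝ) (g : ℝ → E) :
    ∫ x, g x ∂(weightMeasure α β) = ∫ x in (-1 : ℝ)..1, weight α β x • g x := by
  rw [weightMeasure, integral_withDensity_eq_integral_toReal_smul
    (measurable_weight α β).ennreal_ofReal (by simp),
    intervalIntegral.integral_of_le (by norm_num), ← integral_Icc_eq_integral_Ioc]
  refine setIntegral_congr_fun measurableSet_I fun x hx => ?_
  simp [ENNReal.toReal_ofReal (weight_nonneg hx)]

lemma memLp_of_continuousOn {α β : ℝ} (hα : -1 < α) (hβ : -1 < β) {E : Type*}
    [NormedAddCommGroup E] {f : ℝ → E} (hf : ContinuousOn f I) (p : ENNReal) :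
    MemLp f p (weightMeasure α β) := by
  have := isFiniteMeasure_weightMeasure hα hβ
  obtain ⟨C, hC⟩ := isCompact_I.exists_bound_of_continuousOn hf
  refine MemLp.of_bound ?_ C ((ae_mem_I α β).mono hC)
  exact (hf.aestronglyMeasurable_of_isCompact isCompact_I measurableSet_I).mono_ac
    (withDensity_absolutelyContinuous _ _)

lemma integrable_of_continuousOn {α β : ℝ} (hα : -1 < α) (hβ : -1 < β) {E : Type*}
    [NormedAddCommGroup E] {f : ℝ → E} (hf : ContinuousOn f I) :
    Integrable f (weightMeasure α β) :=
  memLp_one_iff_integrable.1 (memLp_of_continuousOn hα hβ hf 1)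

lemma eqOn_of_ae_eq {α β : ℝ} {f g : ℝ → ℝ} (hf : ContinuousOn f I) (hg : ContinuousOn g I)
    (h : f =ᵐ[weightMeasure α β] g) : EqOn f g I := by
  refine Measure.eqOn_Icc_of_ae_eq volume (by norm_num) ?_ hf hg
  rw [Filter.EventuallyEq, weightMeasure,
    ae_withDensity_iff (measurable_weight α β).ennreal_ofReal] at h
  have h1 : ∀ᵐ x ∂(volume.restrict I), x ∈ Ioo (-1 : ℝ) 1 := by
    rw [I, ← restrict_Ioo_eq_restrict_Icc]
    exact ae_restrict_mem measurableSet_Ioo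
  filter_upwards [h, h1] with x hx hx1
  exact hx (by simpa using weight_pos hx1)

/-- Polynomials are dense in `L²(weightMeasure α β)`: Weierstrass' theorem reduces the pairing with
a smooth compactly supported function to pairings with polynomials. -/
lemma ae_eq_zero_of_forall_integral_polynomial {α β : ℝ} (hα : -1 < α) (hβ : -1 < β) {g : ℝ → ℝ}
    (hg : MemLp g 2 (weightMeasure α β))
    (h : ∀ p : Polynomial ℝ, ∫ x, p.eval x * g x ∂(weightMeasure α β) = 0) :
    g =ᵐ[weightMeasure α β] 0 := by
  have := isFiniteMeasure_weightMeasure hα hβ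
  have hgi : Integrable g (weightMeasure α β) := hg.integrable (by norm_num)
  refine ae_eq_zero_of_integral_contDiff_smul_eq_zero hgi.locallyIntegrable fun u hu _ => ?_
  have hmul : ∀ v : ℝ → ℝ, ContinuousOn v I →
      Integrable (fun x => v x * g x) (weightMeasure α β) := fun v hv =>
    (memLp_of_continuousOn hα hβ hv 2).integrable_mul hg
  refine abs_eq_zero.1 (le_antisymm (le_of_forall_pos_le_add fun ε hε => ?_) (abs_nonneg _))
  set A := ∫ x, |g x| ∂(weightMeasure α β) with hA
  have hA0 : 0 ≤ A := integral_nonneg fun _ => abs_nonneg _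
  obtain ⟨p, hp⟩ := exists_polynomial_near_of_continuousOn (-1) 1 u hu.continuous.continuousOn
    (ε / (A + 1)) (by positivity)
  have e1 : ∫ x, u x • g x ∂(weightMeasure α β)
      = ∫ x, (u x - p.eval x) * g x ∂(weightMeasure α β) := by
    simp only [sub_mul, smul_eq_mul]
    rw [integral_sub (hmul _ hu.continuous.continuousOn) (hmul _ p.continuous.continuousOn), h p,
      sub_zero]
  rw [e1, zero_add, ← Real.norm_eq_abs]
  calc _ ≤ ∫ x, ε / (A + 1) * |g x| ∂(weightMeasure α β) := by
        refine norm_integral_le_of_norm_le (hgi.abs.const_mul _) ?_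
        filter_upwards [ae_mem_I α β] with x hx
        rw [norm_mul, Real.norm_eq_abs, Real.norm_eq_abs]
        gcongr
        rw [abs_sub_comm]
        exact (hp x hx).le
    _ = ε * (A / (A + 1)) := by rw [integral_const_mul]; ring
    _ ≤ ε * 1 := by
        gcongr
        rw [div_le_one (by positivity)]
        linarith
    _ = ε := mul_one _

end PerturbedJacobi
namespace PerturbedJacobi

/-! ### The operator on twice continuously differentiable functions -/

section Calculus

variable {u v : ℝ → ℝ} {c α β : ℝ}

lemma contDiffOn_derivWithin (hu : ContDiffOn ℝ 2 u I) : ContDiffOn ℝ 1 (derivWithin u I) I :=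
  hu.derivWithin uniqueDiffOn_I (by norm_num)

lemma continuousOn_derivWithin (hu : ContDiffOn ℝ 2 u I) : ContinuousOn (derivWithin u I) I :=
  (contDiffOn_derivWithin hu).continuousOn

lemma continuousOn_derivWithin_derivWithin (hu : ContDiffOn ℝ 2 u I) :
    ContinuousOn (derivWithin (derivWithin u I) I) I :=
  (contDiffOn_derivWithin hu).continuousOn_derivWithin uniqueDiffOn_I le_rfl

lemma hasDerivAt_derivWithin (hu : ContDiffOn ℝ 2 u I) {x : ℝ} (hx : x ∈ Ioo (-1 : ℝ) 1) :
    HasDerivAt u (derivWithin u I x) x :=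
  ((hu.differentiableOn (by norm_num)) x (Ioo_subset_I hx)).hasDerivWithinAt.hasDerivAt
    (Icc_mem_nhds hx.1 hx.2)

lemma hasDerivAt_derivWithin_derivWithin (hu : ContDiffOn ℝ 2 u I) {x : ℝ}
    (hx : x ∈ Ioo (-1 : ℝ) 1) :
    HasDerivAt (derivWithin u I) (derivWithin (derivWithin u I) I x) x :=
  (((contDiffOn_derivWithin hu).differentiableOn (by norm_num)) x
    (Ioo_subset_I hx)).hasDerivWithinAt.hasDerivAt (Icc_mem_nhds hx.1 hx.2)

lemma continuousOn_op (c α β : ℝ) (hu : ContDiffOn ℝ 2 u I) : ContinuousOn (op c α β u) I := by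
  have h0 := hu.continuousOn
  have h1 := continuousOn_derivWithin hu
  have h2 := continuousOn_derivWithin_derivWithin hu
  unfold op
  fun_prop

lemma op_eq_deriv (hu : ContDiff ℝ 2 u) {x : ℝ} (hx : x ∈ I) :
    op c α β u x = (1 - x ^ 2) * deriv (deriv u) x
      + ((β - α) - (α + β + 2) * x) * deriv u x - c ^ 2 * x ^ 2 * u x := by
  have h1 : EqOn (derivWithin u I) (deriv u) I := fun y hy =>
    (hu.differentiable (by norm_num) y).derivWithin (uniqueDiffOn_I y hy)
  have hd : ContDiff ℝ 1 (deriv u) := by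
    have : ContDiff ℝ (1 + 1) u := by simpa [one_add_one_eq_two] using hu
    exact (contDiff_succ_iff_deriv.1 this).2.2
  have h2 : derivWithin (derivWithin u I) I x = deriv (deriv u) x := by
    rw [derivWithin_congr h1 (h1 hx)]
    exact (hd.differentiable (by norm_num) x).derivWithin (uniqueDiffOn_I x hx)
  rw [op, h1 hx, h2]

/-- The coefficient `(1 - x²) ω(x)` of the self-adjoint form of the operator vanishes at the
endpoints, which is why no boundary condition is needed. -/
lemma weight_add_one {x : ℝ} (hx : x ∈ Ioo (-1 : ℝ) 1) :
    weight (α + 1) (β + 1) x = (1 - x ^ 2) * weight α β x := by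
  have h1 : 1 - x ≠ 0 := by linarith [hx.2]
  have h2 : 1 + x ≠ 0 := by linarith [hx.1]
  rw [weight, weight, Real.rpow_add_one h1, Real.rpow_add_one h2]
  ring

lemma continuous_weight_add_one (hα : -1 < α) (hβ : -1 < β) :
    Continuous (weight (α + 1) (β + 1)) := by
  unfold weight
  refine Continuous.mul ?_ ?_
  · exact Continuous.rpow_const (by fun_prop) fun x => Or.inr (by linarith)
  · exact Continuous.rpow_const (by fun_prop) fun x => Or.inr (by linarith)

lemma weight_add_one_one (hα : -1 < α) : weight (α + 1) (β + 1) 1 = 0 := by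
  rw [weight, sub_self, Real.zero_rpow (by linarith), zero_mul]

lemma weight_add_one_neg_one (hβ : -1 < β) : weight (α + 1) (β + 1) (-1) = 0 := by
  rw [weight, add_neg_cancel, Real.zero_rpow (by linarith : β + 1 ≠ 0), mul_zero]

lemma hasDerivAt_weight_add_one {x : ℝ} (hx : x ∈ Ioo (-1 : ℝ) 1) :
    HasDerivAt (weight (α + 1) (β + 1))
      (weight α β x * ((β - α) - (α + β + 2) * x)) x := by
  have h1 : 1 - x ≠ 0 := by linarith [hx.2]
  have h2 : 1 + x ≠ 0 := by linarith [hx.1]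
  have d1 : HasDerivAt (fun x : ℝ => (1 - x) ^ (α + 1)) (-1 * (α + 1) * (1 - x) ^ (α + 1 - 1)) x :=
    HasDerivAt.rpow_const (by simpa using (hasDerivAt_id x).const_sub 1) (Or.inl h1)
  have d2 : HasDerivAt (fun x : ℝ => (1 + x) ^ (β + 1)) (1 * (β + 1) * (1 + x) ^ (β + 1 - 1)) x :=
    HasDerivAt.rpow_const (by simpa using (hasDerivAt_id x).const_add 1) (Or.inl h2)
  refine (d1.mul d2).congr_deriv ?_
  rw [add_sub_cancel_right, add_sub_cancel_right, weight, Real.rpow_add_one h1,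
    Real.rpow_add_one h2]
  ring

/-- The Wronskian of `u` and `v`, multiplied by `(1 - x²) ω(x)`. -/
noncomputable def wronskian (α β : ℝ) (u v : ℝ → ℝ) (x : ℝ) : ℝ :=
  weight (α + 1) (β + 1) x * (derivWithin u I x * v x - u x * derivWithin v I x)

lemma continuousOn_wronskian (hα : -1 < α) (hβ : -1 < β) (hu : ContDiffOn ℝ 2 u I)
    (hv : ContDiffOn ℝ 2 v I) : ContinuousOn (wronskian α β u v) I := by
  have h0 := hu.continuousOn
  have h1 := continuousOn_derivWithin hu
  have h2 := hv.continuousOn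
  have h3 := continuousOn_derivWithin hv
  have h4 := (continuous_weight_add_one hα hβ).continuousOn (s := I)
  unfold wronskian
  fun_prop

/-- Lagrange's identity. -/
lemma hasDerivAt_wronskian (c d : ℝ) (hu : ContDiffOn ℝ 2 u I) (hv : ContDiffOn ℝ 2 v I) {x : ℝ}
    (hx : x ∈ Ioo (-1 : ℝ) 1) :
    HasDerivAt (wronskian α β u v)
      (weight α β x * (op c α β u x * v x - u x * op d α β v x
        + (c ^ 2 - d ^ 2) * x ^ 2 * u x * v x)) x := by
  refine ((hasDerivAt_weight_add_one hx).mul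
    (((hasDerivAt_derivWithin_derivWithin hu hx).mul (hasDerivAt_derivWithin hv hx)).sub
    ((hasDerivAt_derivWithin hu hx).mul
      (hasDerivAt_derivWithin_derivWithin hv hx)))).congr_deriv ?_
  rw [weight_add_one hx, op, op]
  simp only [Pi.sub_apply, Pi.mul_apply]
  ring

/-- The operator is symmetric on `C²(I)`. -/
lemma integral_op_mul (hα : -1 < α) (hβ : -1 < β) (hu : ContDiffOn ℝ 2 u I)
    (hv : ContDiffOn ℝ 2 v I) :
    ∫ x, op c α β u x * v x ∂(weightMeasure α β) = ∫ x, u x * op c α β v x ∂(weightMeasure α β) := by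
  have c1 : ContinuousOn (fun x => op c α β u x * v x) I :=
    (continuousOn_op c α β hu).mul hv.continuousOn
  have c2 : ContinuousOn (fun x => u x * op c α β v x) I :=
    hu.continuousOn.mul (continuousOn_op c α β hv)
  rw [← sub_eq_zero, ← integral_sub (integrable_of_continuousOn hα hβ c1)
    (integrable_of_continuousOn hα hβ c2), integral_weightMeasure]
  simp only [smul_eq_mul]
  rw [intervalIntegral.integral_eq_sub_of_hasDerivAt_of_le (f := wronskian α β u v) (by norm_num)
    (continuousOn_wronskian hα hβ hu hv)
    (fun x hx => (hasDerivAt_wronskian c c hu hv hx).congr_deriv (by ring))]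
  · simp [wronskian, weight_add_one_one hα, weight_add_one_neg_one hβ]
  · refine (intervalIntegrable_weight hα hβ).mul_continuousOn ?_
    rw [uIcc_of_le (by norm_num)]
    exact c1.sub c2

lemma contDiffOn_comp_neg (hu : ContDiffOn ℝ 2 u I) : ContDiffOn ℝ 2 (fun x => u (-x)) I :=
  hu.comp contDiff_neg.contDiffOn fun _ hx => neg_mem_I hx

lemma neg_I : -I = I := by
  ext x
  exact ⟨fun h => by simpa using neg_mem_I h, fun h => neg_mem_I h⟩

lemma op_comp_neg (x : ℝ) :
    op c α β (fun x => u (-x)) x = op c β α u (-x) := by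
  have h1 : derivWithin (fun x => u (-x)) I = fun x => -derivWithin u I (-x) := by
    ext y
    rw [derivWithin_comp_neg, neg_I]
  have h2 : derivWithin (fun x => -derivWithin u I (-x)) I x
      = derivWithin (derivWithin u I) I (-x) := by
    rw [derivWithin.fun_neg, derivWithin_comp_neg, neg_I, neg_neg]
  rw [op, h1, h2, op]
  ring

lemma IsEigenpair.comp_neg {χ : ℝ} (h : IsEigenpair c α β χ u) :
    IsEigenpair c β α χ fun x => u (-x) where
  contDiffOn := contDiffOn_comp_neg h.contDiffOn
  ne_zero := by
    obtain ⟨x, hx, hne⟩ := h.ne_zero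
    exact ⟨-x, neg_mem_I hx, by simpa using hne⟩
  eigen x hx := by rw [op_comp_neg, h.eigen _ (neg_mem_I hx)]

lemma isEigenvalue_swap_iff {χ : ℝ} : IsEigenvalue c α β χ ↔ IsEigenvalue c β α χ :=
  ⟨fun ⟨_, h⟩ => ⟨_, h.comp_neg⟩, fun ⟨_, h⟩ => ⟨_, h.comp_neg⟩⟩

/-- Changing the parameter `c` only changes the zeroth order term. -/
lemma op_eq_op_add (c d : ℝ) (x : ℝ) :
    op c α β u x = op d α β u x - (c ^ 2 - d ^ 2) * x ^ 2 * u x := by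
  rw [op, op]; ring

end Calculus

end PerturbedJacobi
namespace PerturbedJacobi

/-! ### Bounded perturbations of diagonal operators with compact resolvent -/

section DiagonalPerturbation

open Filter Topology InnerProductSpace

variable {H : Type*} [NormedAddCommGroup H] [InnerProductSpace ℝ H]

lemma eq_of_forall_inner_hilbertBasis (e : HilbertBasis ℕ ℝ H) {f g : H}
    (h : ∀ n, inner ℝ (e n) f = inner ℝ (e n) g) : f = g := by
  refine e.repr.injective (lp.ext (funext fun n => ?_))
  rw [e.repr_apply_apply, e.repr_apply_apply, h n]

/-- A bounded sequence defines a bounded diagonal operator in a Hilbert basis. -/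
lemma exists_diagonal_operator (e : HilbertBasis ℕ ℝ H) (a : ℕ → ℝ) (C : ℝ) (ha : ∀ n, |a n| ≤ C) :
    ∃ K : H →L[ℝ] H, (∀ f n, inner ℝ (e n) (K f) = a n * inner ℝ (e n) f) ∧ ‖K‖ ≤ C := by
  have hC : 0 ≤ C := (abs_nonneg _).trans (ha 0)
  have hsq : ∀ n, a n ^ 2 ≤ C ^ 2 := fun n => sq_le_sq.2 (by rw [abs_of_nonneg hC]; exact ha n)
  have key : ∀ f : H, Summable fun n => (a n * e.repr f n) ^ 2 := fun f => by
    have h1 : Summable fun n => (e.repr f n) ^ 2 := by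
      have := (lp.memℓp (e.repr f)).summable (by norm_num)
      simpa using this
    refine (h1.mul_left (C ^ 2)).of_nonneg_of_le (fun n => sq_nonneg _) fun n => ?_
    rw [mul_pow]
    exact mul_le_mul_of_nonneg_right (hsq n) (sq_nonneg _)
  have hmem : ∀ f : H, Memℓp (fun n => a n * e.repr f n : ℕ → ℝ) 2 := fun f =>
    memℓp_gen (by simpa [mul_pow] using key f)
  let L : H →ₗ[ℝ] H :=
    { toFun := fun f => e.repr.symm ⟨fun n => a n * e.repr f n, hmem f⟩
      map_add' := fun f g => by
        rw [← map_add]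
        congr 1
        ext n
        simp [mul_add]
        rfl
      map_smul' := fun r f => by
        simp only [RingHom.id_apply]
        rw [← map_smul]
        congr 1
        ext n
        simp [mul_left_comm] }
  have hL : ∀ f n, inner ℝ (e n) (L f) = a n * inner ℝ (e n) f := fun f n => by
    rw [← e.repr_apply_apply, ← e.repr_apply_apply]
    simp [L]
  have hb : ∀ f, ‖L f‖ ≤ C * ‖f‖ := fun f => by
    have h1 : ‖L f‖ ^ 2 = ∑' n, (a n * e.repr f n) ^ 2 := by
      have := lp.norm_rpow_eq_tsum (p := 2) (by norm_num) (e.repr (L f))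
      rw [LinearIsometryEquiv.norm_map] at this
      simpa [L, mul_pow] using this
    have h2 : ‖f‖ ^ 2 = ∑' n, (e.repr f n) ^ 2 := by
      have := lp.norm_rpow_eq_tsum (p := 2) (by norm_num) (e.repr f)
      rw [LinearIsometryEquiv.norm_map] at this
      simpa using this
    have h3 : Summable fun n => (e.repr f n) ^ 2 := by
      have := (lp.memℓp (e.repr f)).summable (by norm_num)
      simpa using this
    refine le_of_sq_le_sq ?_ (by positivity)
    rw [mul_pow, h1, h2, ← tsum_mul_left]
    refine (key f).tsum_le_tsum (fun n => ?_) (h3.mul_left _)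
    rw [mul_pow]
    exact mul_le_mul_of_nonneg_right (hsq n) (sq_nonneg _)
  exact ⟨L.mkContinuous C hb, hL, L.mkContinuous_norm_le hC hb⟩

lemma isCompactOperator_of_diagonal [CompleteSpace H] (e : HilbertBasis ℕ ℝ H) (a : ℕ → ℝ)
    (ha : Tendsto a atTop (𝓝 0)) (K : H →L[ℝ] H)
    (hK : ∀ f n, inner ℝ (e n) (K f) = a n * inner ℝ (e n) f) : IsCompactOperator K := by
  let F : ℕ → H →L[ℝ] H := fun N => ∑ n ∈ Finset.range N,
    a n • (ContinuousLinearMap.toSpanSingleton ℝ (e n)).comp (innerSL ℝ (e n))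
  have hF : ∀ N f m, inner ℝ (e m) (F N f) = if m < N then a m * inner ℝ (e m) f else 0 := by
    intro N f m
    have ho := orthonormal_iff_ite.1 e.orthonormal
    simp only [F, _root_.sum_apply, inner_sum, _root_.smul_apply,
      ContinuousLinearMap.comp_apply, ContinuousLinearMap.toSpanSingleton_apply, inner_smul_right,
      innerSL_apply_apply, ho]
    simp
  refine isCompactOperator_of_tendsto (l := atTop) (F := F) ?_ (Eventually.of_forall fun N => ?_)
  · rw [tendsto_iff_norm_sub_tendsto_zero, Metric.tendsto_atTop]
    intro ε hε
    obtain ⟨N, hN⟩ := Metric.tendsto_atTop.1 ha (ε / 2) (by positivity)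
    refine ⟨N, fun M hM => ?_⟩
    obtain ⟨G, hG, hGn⟩ := exists_diagonal_operator e (fun n => if n < M then 0 else -a n) (ε / 2)
      fun n => by
        split_ifs with h
        · simpa using by positivity
        · have := hN n (by omega)
          rw [dist_zero_right, Real.norm_eq_abs] at this
          rw [abs_neg]
          exact this.le
    have : F M - K = G := by
      ext f
      refine eq_of_forall_inner_hilbertBasis e fun n => ?_
      rw [hG, _root_.sub_apply, inner_sub_right, hF, hK]
      split_ifs <;> ring
    rw [this, dist_zero_right, norm_norm]
    linarith
  · have hc : ∀ n, IsCompactOperator (a n • (ContinuousLinearMap.toSpanSingleton ℝ (e n)).comp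
        (innerSL ℝ (e n))) := fun n => by
      refine IsCompactOperator.smul ?_ (a n)
      exact IsCompactOperator.comp_clm (isCompactOperator_of_locallyCompactSpace_rng
        (ContinuousLinearMap.toSpanSingleton ℝ (e n))) _
    induction N with
    | zero => simpa [F] using isCompactOperator_zero
    | succ N ih =>
      have : F (N + 1) = F N + a N • (ContinuousLinearMap.toSpanSingleton ℝ (e N)).comp
        (innerSL ℝ (e N)) := Finset.sum_range_succ _ _
      rw [this]
      exact ih.add (hc N)

/-- Let `D` be the diagonal operator with entries `d n → ∞` and `M` a symmetric bounded operator with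
`‖M‖ < κ ≤ d n`. The eigenvectors of `D + M` (in the weak sense, tested against the basis) have
dense span. Indeed `(D + M)⁻¹ = K (1 + K M K)⁻¹ K` with `K = D^{-1/2}` is compact and symmetric. -/
theorem eq_zero_of_forall_inner_weak_eigenvector [CompleteSpace H] (e : HilbertBasis ℕ ℝ H)
    (d : ℕ → ℝ) (κ : ℝ) (hd : Tendsto d atTop atTop) (hκ : ∀ n, κ ≤ d n) (M : H →L[ℝ] H)
    (hM : ∀ f g, inner ℝ (M f) g = inner ℝ f (M g)) (hMκ : ‖M‖ < κ) (g : H)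
    (hg : ∀ (f : H) (ν : ℝ),
      (∀ n, d n * inner ℝ (e n) f + inner ℝ (e n) (M f) = ν * inner ℝ (e n) f) → inner ℝ f g = 0) :
    g = 0 := by
  have hκ0 : 0 < κ := (norm_nonneg _).trans_lt hMκ
  have hd0 : ∀ n, 0 < d n := fun n => hκ0.trans_le (hκ n)
  have hs0 : ∀ n, 0 < √(d n) := fun n => Real.sqrt_pos.2 (hd0 n)
  obtain ⟨K, hK, hKn⟩ := exists_diagonal_operator e (fun n => (√(d n))⁻¹) (√κ)⁻¹ fun n => by
    rw [abs_of_pos (inv_pos.2 (hs0 n))]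
    exact inv_anti₀ (Real.sqrt_pos.2 hκ0) (Real.sqrt_le_sqrt (hκ n))
  have hKc : IsCompactOperator K := isCompactOperator_of_diagonal e _
    (tendsto_inv_atTop_zero.comp (Real.tendsto_sqrt_atTop.comp hd)) K hK
  have hKs : ∀ f g, inner ℝ (K f) g = inner ℝ f (K g) := fun f g => by
    rw [← e.tsum_inner_mul_inner, ← e.tsum_inner_mul_inner]
    refine tsum_congr fun n => ?_
    rw [real_inner_comm, hK, hK, real_inner_comm (e n) f]
    ring
  set X : H →L[ℝ] H := -(K * M * K) with hX
  have hXn : ‖X‖ < 1 := by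
    rw [hX, norm_neg]
    calc ‖K * M * K‖ ≤ ‖K‖ * ‖M‖ * ‖K‖ := (norm_mul_le _ _).trans (by gcongr; exact norm_mul_le _ _)
      _ ≤ (√κ)⁻¹ * ‖M‖ * (√κ)⁻¹ := by gcongr
      _ = ‖M‖ / κ := by
        rw [mul_right_comm, ← mul_inv, Real.mul_self_sqrt hκ0.le]
        ring
      _ < 1 := by rwa [div_lt_one hκ0]
  set U := Units.oneSub X hXn with hU
  set R : H →L[ℝ] H := ↑U⁻¹ with hR
  have hUv : ∀ h, (U : H →L[ℝ] H) h = h + K (M (K h)) := fun h => by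
    simp [hU, hX, Units.val_oneSub]
  have hUR : ∀ h, R h + K (M (K (R h))) = h := fun h => by
    rw [← hUv, ← mul_apply_eq_comp, Units.mul_inv, one_apply_eq_self]
  have hUs : ∀ f g, inner ℝ (f + K (M (K f))) g = inner ℝ f (g + K (M (K g))) := fun f g => by
    rw [inner_add_left, inner_add_right, hKs, hM, hKs]
  have hRs : ∀ f g, inner ℝ (R f) g = inner ℝ f (R g) := fun f g => by
    conv_lhs => rw [← hUR g]
    rw [← hUs, hUR]
  set T : H →L[ℝ] H := K * R * K with hT
  have hTa : ∀ f, T f = K (R (K f)) := fun f => rfl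
  have hTs : T.IsSymmetric := fun f g => by
    simp only [ContinuousLinearMap.coe_coe, hTa]
    rw [hKs, hRs, hKs]
  have hTc : IsCompactOperator T := hKc.comp_clm (R * K)
  have hspec := ContinuousLinearMap.orthogonalComplement_iSup_eigenspaces_eq_bot hTc hTs
  have hgm : g ∈ (⨆ μ, Module.End.eigenspace (T : Module.End ℝ H) μ)ᗮ := by
    rw [← Submodule.iInf_orthogonal, Submodule.mem_iInf]
    intro μ
    rw [Submodule.mem_orthogonal]
    intro f hf
    rw [Module.End.mem_eigenspace_iff, ContinuousLinearMap.coe_coe, hTa] at hf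
    have hμ : ∀ n, μ * inner ℝ (e n) f = (√(d n))⁻¹ * inner ℝ (e n) (R (K f)) := fun n => by
      rw [← hK, hf, inner_smul_right]
    have hn : ∀ n, inner ℝ (e n) (R (K f)) + (√(d n))⁻¹ * (μ * inner ℝ (e n) (M f))
        = (√(d n))⁻¹ * inner ℝ (e n) f := fun n => by
      have := congrArg (inner ℝ (e n)) (hUR (K f))
      rw [inner_add_right, hK, hK, hf, map_smul, inner_smul_right] at this
      exact this
    have hs : ∀ n, √(d n) * √(d n) = d n := fun n => Real.mul_self_sqrt (hd0 n).le
    rcases eq_or_ne μ 0 with rfl | hμ0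
    · have : f = 0 := eq_of_forall_inner_hilbertBasis e fun n => by
        have h1 := hμ n
        have h2 := hn n
        have h3 := inv_pos.2 (hs0 n)
        rw [zero_mul, eq_comm, mul_eq_zero, or_iff_right h3.ne'] at h1
        rw [h1, zero_mul, mul_zero, add_zero, eq_comm, mul_eq_zero, or_iff_right h3.ne'] at h2
        rw [h2, inner_zero_right]
      rw [this, inner_zero_left]
    · refine hg f μ⁻¹ fun n => ?_
      have h1 := hμ n
      have h2 := hn n
      have h3 := (hs0 n).ne'
      have h4 : inner ℝ (e n) (R (K f)) = √(d n) * (μ * inner ℝ (e n) f) := by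
        rw [h1, mul_inv_cancel_left₀ h3]
      rw [h4] at h2
      have h5 : d n * (μ * inner ℝ (e n) f) + μ * inner ℝ (e n) (M f) = inner ℝ (e n) f := by
        have := congrArg (√(d n) * ·) h2
        simp only [mul_add, mul_inv_cancel_left₀ h3, ← mul_assoc, hs] at this
        linear_combination this
      rw [eq_inv_mul_iff_mul_eq₀ hμ0]
      linear_combination h5
  rwa [hspec, Submodule.mem_bot] at hgm

end DiagonalPerturbation

end PerturbedJacobi
namespace PerturbedJacobi

/-! ### Jacobi polynomials -/

section Jacobi

open Polynomial

variable {α β : ℝ}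

/-- The `n`-th eigenvalue `n (n + α + β + 1)` of the unperturbed operator. -/
noncomputable def jacobiEigenvalue (α β : ℝ) (n : ℕ) : ℝ := n * (n + α + β + 1)

/-- The `k`-th coefficient of the `n`-th Jacobi polynomial in powers of `1 - x`. -/
noncomputable def jacobiCoeff (α β : ℝ) (n k : ℕ) : ℝ :=
  ∏ j ∈ Finset.range k,
    (jacobiEigenvalue α β j - jacobiEigenvalue α β n) / (2 * (j + 1) * (j + 1 + α))

/-- The `n`-th Jacobi polynomial, normalized to have the value `1` at the point `1`. -/
noncomputable def jacobiPoly (α β : ℝ) (n : ℕ) : ℝ[X] :=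
  ∑ k ∈ Finset.range (n + 1), C (jacobiCoeff α β n k) * (1 - X) ^ k

lemma jacobiEigenvalue_strictMono (hα : -1 < α) (hβ : -1 < β) :
    StrictMono (jacobiEigenvalue α β) := by
  refine strictMono_nat_of_lt_succ fun n => ?_
  have : (0 : ℝ) ≤ n := n.cast_nonneg
  rw [jacobiEigenvalue, jacobiEigenvalue]
  push_cast
  nlinarith

lemma jacobiEigenvalue_nonneg (hα : -1 < α) (hβ : -1 < β) (n : ℕ) : 0 ≤ jacobiEigenvalue α β n := by
  have := (jacobiEigenvalue_strictMono hα hβ).monotone n.zero_le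
  simpa [jacobiEigenvalue] using this

lemma jacobiEigenvalue_add_one_sub (n : ℕ) :
    jacobiEigenvalue α β (n + 1) - jacobiEigenvalue α β n = 2 * n + (α + β + 2) := by
  rw [jacobiEigenvalue, jacobiEigenvalue]
  push_cast
  ring

lemma tendsto_jacobiEigenvalue (α β : ℝ) :
    Filter.Tendsto (jacobiEigenvalue α β) Filter.atTop Filter.atTop := by
  have h := tendsto_natCast_atTop_atTop (R := ℝ)
  unfold jacobiEigenvalue
  refine h.atTop_mul_atTop₀ ?_
  simp only [add_assoc]
  exact Filter.tendsto_atTop_add_const_right _ _ h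

lemma jacobiEigenvalue_le (n : ℕ) :
    jacobiEigenvalue α β n ≤ (1 + |α + β + 1|) * (n : ℝ) ^ 2 := by
  rcases Nat.eq_zero_or_pos n with rfl | hn
  · simp [jacobiEigenvalue]
  · have h1 : (1 : ℝ) ≤ n := by exact_mod_cast hn
    have h2 := le_abs_self (α + β + 1)
    have h3 := abs_nonneg (α + β + 1)
    rw [jacobiEigenvalue]
    nlinarith [mul_nonneg h3 (sub_nonneg.2 h1)]

lemma jacobiCoeff_zero (n : ℕ) : jacobiCoeff α β n 0 = 1 := by simp [jacobiCoeff]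

lemma jacobiCoeff_succ (n k : ℕ) : jacobiCoeff α β n (k + 1) = jacobiCoeff α β n k *
    ((jacobiEigenvalue α β k - jacobiEigenvalue α β n) / (2 * (k + 1) * (k + 1 + α))) :=
  Finset.prod_range_succ _ _

lemma two_mul_jacobiCoeff_succ (hα : -1 < α) (n k : ℕ) :
    2 * (k + 1) * (k + 1 + α) * jacobiCoeff α β n (k + 1)
      = jacobiCoeff α β n k * (jacobiEigenvalue α β k - jacobiEigenvalue α β n) := by
  have h0 : (0 : ℝ) ≤ k := k.cast_nonneg
  have h1 : (k : ℝ) + 1 ≠ 0 := by positivity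
  have h2 : (k : ℝ) + 1 + α ≠ 0 := by linarith
  rw [jacobiCoeff_succ]
  field_simp

lemma jacobiCoeff_self_ne_zero (hα : -1 < α) (hβ : -1 < β) (n : ℕ) : jacobiCoeff α β n n ≠ 0 := by
  refine Finset.prod_ne_zero_iff.2 fun j hj => div_ne_zero ?_ ?_
  · exact sub_ne_zero.2 (jacobiEigenvalue_strictMono hα hβ (Finset.mem_range.1 hj)).ne
  · have h0 : (0 : ℝ) ≤ j := j.cast_nonneg
    have : 0 < (j : ℝ) + 1 + α := by linarith
    positivity

lemma degree_one_sub_X_pow (k : ℕ) : ((1 - X : ℝ[X]) ^ k).degree = k := by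
  have : (1 - X : ℝ[X]).degree = 1 := by
    rw [← neg_sub, degree_neg, ← C_1, degree_X_sub_C]
  rw [degree_pow, this]
  simp

lemma degree_jacobiPoly (hα : -1 < α) (hβ : -1 < β) (n : ℕ) :
    (jacobiPoly α β n).degree = n := by
  have hlast : (C (jacobiCoeff α β n n) * (1 - X : ℝ[X]) ^ n).degree = n := by
    rw [degree_C_mul (jacobiCoeff_self_ne_zero hα hβ n), degree_one_sub_X_pow]
  rw [jacobiPoly, Finset.sum_range_succ, degree_add_eq_right_of_degree_lt, hlast]
  rw [hlast]
  refine (degree_sum_le _ _).trans_lt ((Finset.sup_lt_iff (WithBot.bot_lt_coe n)).2 fun k hk => ?_)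
  rw [← smul_eq_C_mul]
  refine (degree_smul_le _ _).trans_lt ?_
  rw [degree_one_sub_X_pow]
  exact Nat.cast_lt.2 (Finset.mem_range.1 hk)

/-- The Jacobi polynomials, as a sequence with one polynomial of each degree. -/
noncomputable def jacobiSequence (hα : -1 < α) (hβ : -1 < β) : Polynomial.Sequence ℝ where
  elems' := jacobiPoly α β
  degree_eq' := degree_jacobiPoly hα hβ

lemma contDiff_eval (p : ℝ[X]) : ContDiff ℝ 2 fun x => p.eval x := by
  simpa only [← coe_aeval_eq_eval] using p.contDiff_aeval 2

lemma op_eval (c : ℝ) (p : ℝ[X]) {x : ℝ} (hx : x ∈ I) :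
    op c α β (fun x => p.eval x) x = (1 - x ^ 2) * (derivative (derivative p)).eval x
      + ((β - α) - (α + β + 2) * x) * (derivative p).eval x - c ^ 2 * x ^ 2 * p.eval x := by
  have h : deriv (fun x => p.eval x) = fun x => (derivative p).eval x := by
    ext x
    exact p.deriv
  rw [op_eq_deriv (contDiff_eval p) hx, h, Polynomial.deriv]

lemma op_zero_jacobiPoly (hα : -1 < α) (n : ℕ) {x : ℝ} (hx : x ∈ I) :
    op 0 α β (fun x => (jacobiPoly α β n).eval x) x
      = -jacobiEigenvalue α β n * (jacobiPoly α β n).eval x := by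
  -- the partial sums over `k < N` telescope, by the recurrence for the coefficients
  have key : ∀ N : ℕ, ∑ k ∈ Finset.range N, ((1 - x ^ 2)
        * (derivative (derivative (C (jacobiCoeff α β n k) * (1 - X) ^ k))).eval x
      + ((β - α) - (α + β + 2) * x)
        * (derivative (C (jacobiCoeff α β n k) * (1 - X) ^ k)).eval x
      + jacobiEigenvalue α β n * (C (jacobiCoeff α β n k) * (1 - X) ^ k).eval x)
      = -(2 * N * (N + α) * jacobiCoeff α β n N) * (1 - x) ^ (N - 1) := by
    intro N
    induction N with
    | zero => simp
    | succ N ih =>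
      have h := two_mul_jacobiCoeff_succ (β := β) hα n N
      have hN : jacobiEigenvalue α β N = N * (N + α + β + 1) := rfl
      rw [hN] at h
      rw [Finset.sum_range_succ, ih, Nat.add_sub_cancel]
      push_cast
      rw [h]
      rcases N with _ | _ | N
      · simp
        ring
      · simp
        ring
      · simp [derivative_pow]
        ring
  have hz : jacobiCoeff α β n (n + 1) = 0 := by rw [jacobiCoeff_succ]; simp
  have := key (n + 1)
  rw [hz, mul_zero, neg_zero, zero_mul, Finset.sum_add_distrib, Finset.sum_add_distrib,
    ← Finset.mul_sum, ← Finset.mul_sum, ← Finset.mul_sum, ← eval_finsetSum, ← eval_finsetSum,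
    ← eval_finsetSum, ← derivative_sum, ← derivative_sum] at this
  rw [op_eval 0 _ hx]
  rw [jacobiPoly]
  linear_combination this

lemma isEigenpair_jacobiPoly (hα : -1 < α) (hβ : -1 < β) (n : ℕ) :
    IsEigenpair 0 α β (jacobiEigenvalue α β n) fun x => (jacobiPoly α β n).eval x where
  contDiffOn := (contDiff_eval _).contDiffOn
  ne_zero := by
    by_contra! h
    refine (jacobiSequence hα hβ).ne_zero n (eq_zero_of_infinite_isRoot _ ?_)
    exact (Icc_infinite (by norm_num : (-1 : ℝ) < 1)).mono h
  eigen x hx := by rw [op_zero_jacobiPoly hα n hx]; ring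

lemma abs_jacobiCoeff_le (hα : -1 < α) (hβ : -1 < β) :
    ∃ q : ℝ, 0 ≤ q ∧ ∀ n k : ℕ, k ≤ n + 1 →
      |jacobiCoeff α β n k| ≤ ((q * n) ^ k / (k.factorial : ℝ)) ^ 2 := by
  set δ := min 1 (1 + α) with hδ
  have hδ0 : 0 < δ := lt_min one_pos (by linarith)
  set A := (1 + |α + β + 1|) / (2 * δ) with hA
  have hA0 : 0 ≤ A := by positivity
  refine ⟨1 + A, by positivity, fun n k => ?_⟩
  induction k with
  | zero => simp [jacobiCoeff_zero]
  | succ k ih =>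
    intro hk
    have hk0 : (0 : ℝ) ≤ k := k.cast_nonneg
    have h1 : δ * (k + 1) ≤ k + 1 + α := by
      have := min_le_left 1 (1 + α)
      have := min_le_right 1 (1 + α)
      nlinarith
    have hmono := (jacobiEigenvalue_strictMono hα hβ).monotone (show k ≤ n by omega)
    have h2 : |jacobiEigenvalue α β k - jacobiEigenvalue α β n|
        ≤ (1 + |α + β + 1|) * (n : ℝ) ^ 2 := by
      rw [abs_sub_comm, abs_of_nonneg (sub_nonneg.2 hmono)]
      linarith [jacobiEigenvalue_nonneg hα hβ k, jacobiEigenvalue_le (α := α) (β := β) n]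
    have h3 : |(jacobiEigenvalue α β k - jacobiEigenvalue α β n) / (2 * (k + 1) * (k + 1 + α))|
        ≤ ((1 + A) * n / (k + 1)) ^ 2 := by
      rw [abs_div, abs_of_pos (show 0 < 2 * ((k : ℝ) + 1) * (k + 1 + α) by
        have : 0 < (k : ℝ) + 1 + α := by linarith
        positivity)]
      calc _ ≤ (1 + |α + β + 1|) * (n : ℝ) ^ 2 / (2 * (k + 1) * (δ * (k + 1))) := by gcongr
        _ = A * (n / (k + 1)) ^ 2 := by rw [hA]; field_simp
        _ ≤ (1 + A) ^ 2 * (n / (k + 1)) ^ 2 := by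
          gcongr
          nlinarith
        _ = _ := by ring
    rw [jacobiCoeff_succ, abs_mul]
    calc _ ≤ (((1 + A) * n) ^ k / (k.factorial : ℝ)) ^ 2 * ((1 + A) * n / (k + 1)) ^ 2 := by
          gcongr
          exact ih (by omega)
      _ = _ := by
          rw [Nat.factorial_succ, ← mul_pow, pow_succ _ k]
          push_cast
          congr 1
          field_simp

lemma sum_abs_jacobiCoeff_le (hα : -1 < α) (hβ : -1 < β) (Q : ℝ) (hQ : 1 ≤ Q) :
    ∃ B : ℝ, 1 ≤ B ∧ ∀ n : ℕ,
      ∑ k ∈ Finset.range (n + 1), |jacobiCoeff α β n k| * Q ^ k ≤ B ^ n := by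
  obtain ⟨q, hq, h⟩ := abs_jacobiCoeff_le hα hβ
  refine ⟨Real.exp (2 * (q * Q)), Real.one_le_exp (by positivity), fun n => ?_⟩
  have hx : 0 ≤ q * n * Q := by positivity
  calc ∑ k ∈ Finset.range (n + 1), |jacobiCoeff α β n k| * Q ^ k
      ≤ ∑ k ∈ Finset.range (n + 1), Real.exp (q * n * Q)
          * ((q * n * Q) ^ k / (k.factorial : ℝ)) := by
        refine Finset.sum_le_sum fun k hk => ?_
        calc |jacobiCoeff α β n k| * Q ^ k
            ≤ ((q * n) ^ k / (k.factorial : ℝ)) ^ 2 * (Q ^ k) ^ 2 := by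
              have : 1 ≤ Q ^ k := one_le_pow₀ hQ
              gcongr
              · exact h n k (Finset.mem_range.1 hk).le
              · nlinarith
          _ = ((q * n * Q) ^ k / (k.factorial : ℝ)) * ((q * n * Q) ^ k / (k.factorial : ℝ)) := by
              rw [mul_pow (q * n) Q]; ring
          _ ≤ _ := by
              gcongr
              exact Real.pow_div_factorial_le_exp _ hx _
    _ ≤ Real.exp (q * n * Q) * Real.exp (q * n * Q) := by
        rw [← Finset.mul_sum]
        gcongr
        exact Real.sum_le_exp_of_nonneg hx _
    _ = Real.exp (2 * (q * Q)) ^ n := by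
        rw [← Real.exp_add, ← Real.exp_nat_mul]
        ring_nf

/-- On compact subsets of the complex plane the Jacobi polynomials grow at most geometrically. -/
lemma norm_aeval_jacobiPoly_le (hα : -1 < α) (hβ : -1 < β) (R : ℝ) :
    ∃ B : ℝ, 1 ≤ B ∧ ∀ (n : ℕ) (z : ℂ), ‖z‖ ≤ R → ‖aeval z (jacobiPoly α β n)‖ ≤ B ^ n := by
  obtain ⟨B, hB, h⟩ := sum_abs_jacobiCoeff_le hα hβ (1 + |R|) (by linarith [abs_nonneg R])
  refine ⟨B, hB, fun n z hz => le_trans ?_ (h n)⟩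
  rw [jacobiPoly, map_sum]
  refine (norm_sum_le _ _).trans (Finset.sum_le_sum fun k _ => ?_)
  simp only [map_mul, map_pow, aeval_C, map_sub, map_one, aeval_X, norm_mul, norm_pow]
  rw [Complex.coe_algebraMap, Complex.norm_real, Real.norm_eq_abs]
  gcongr
  calc ‖1 - z‖ ≤ ‖(1 : ℂ)‖ + ‖z‖ := norm_sub_le _ _
    _ ≤ 1 + |R| := by
      rw [norm_one]
      linarith [le_abs_self R]

/-- The `L²` norms of the Jacobi polynomials decay at most geometrically, since the polynomials are
close to `1` on a neighbourhood of `1` whose size is at least geometric. -/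
lemma le_integral_jacobiPoly_sq (hα : -1 < α) (hβ : -1 < β) :
    ∃ b : ℝ, 0 < b ∧ ∃ a : ℝ, 0 < a ∧ ∀ n : ℕ,
      a * b ^ n ≤ ∫ x, (jacobiPoly α β n).eval x ^ 2 ∂(weightMeasure α β) := by
  obtain ⟨B, hB, h⟩ := sum_abs_jacobiCoeff_le hα hβ 1 le_rfl
  obtain ⟨m, hm⟩ := exists_nat_ge |α|
  refine ⟨(1 / B) ^ (m + 1), by positivity, (1 / 4) ^ (m + 1) * 2 ^ (-|β|) / 4, by positivity,
    fun n => ?_⟩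
  have hBn : 1 ≤ B ^ n := one_le_pow₀ hB
  set τ := 1 / (4 * B ^ n) with hτ
  have hτ0 : 0 < τ := by positivity
  have hτ1 : τ ≤ 1 / 4 := by
    rw [hτ]
    gcongr
    linarith
  have hτB : 2 * τ * B ^ n = 1 / 2 := by rw [hτ]; field_simp; norm_num
  have hlow : ∀ x ∈ Icc (1 - 2 * τ) (1 - τ), (1 / 4 : ℝ) ≤ (jacobiPoly α β n).eval x ^ 2 := by
    intro x hx
    have h1 : |(jacobiPoly α β n).eval x - 1| ≤ (1 - x) * B ^ n := by
      have e1 : (jacobiPoly α β n).eval x - 1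
          = ∑ k ∈ Finset.range n, jacobiCoeff α β n (k + 1) * (1 - x) ^ (k + 1) := by
        rw [jacobiPoly, eval_finsetSum, Finset.sum_range_succ']
        simp [jacobiCoeff_zero]
      rw [e1]
      refine (Finset.abs_sum_le_sum_abs _ _).trans ?_
      calc _ ≤ ∑ k ∈ Finset.range n, (1 - x) * |jacobiCoeff α β n (k + 1)| := by
            refine Finset.sum_le_sum fun k _ => ?_
            have hx0 : 0 ≤ 1 - x := by linarith [hx.2]
            rw [abs_mul, abs_of_nonneg (pow_nonneg hx0 _), mul_comm]
            gcongr
            rw [pow_succ]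
            have : (1 - x) ^ k ≤ 1 := pow_le_one₀ hx0 (by linarith [hx.1])
            nlinarith
        _ ≤ (1 - x) * B ^ n := by
            rw [← Finset.mul_sum]
            refine mul_le_mul_of_nonneg_left (le_trans ?_ (h n)) (by linarith [hx.2])
            rw [Finset.sum_range_succ']
            simp
    have h2 : |(jacobiPoly α β n).eval x - 1| ≤ 1 / 2 := by
      refine h1.trans ?_
      rw [← hτB]
      gcongr
      linarith [hx.1]
    have h3 := (abs_le.1 h2).1
    nlinarith
  have hw : ∀ x ∈ Icc (1 - 2 * τ) (1 - τ), τ ^ m * 2 ^ (-|β|) ≤ weight α β x := by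
    intro x hx
    have hx1 : τ ≤ 1 - x := by linarith [hx.2]
    have hx2 : 1 - x ≤ 1 := by linarith [hx.1]
    have hx3 : 1 ≤ 1 + x := by linarith [hx.1]
    have hx4 : 1 + x ≤ 2 := by linarith [hx.2]
    rw [weight]
    refine mul_le_mul ?_ ?_ (by positivity) (Real.rpow_nonneg (by linarith) _)
    · calc τ ^ m ≤ (1 - x) ^ m := by gcongr
        _ = (1 - x) ^ (m : ℝ) := (Real.rpow_natCast _ _).symm
        _ ≤ (1 - x) ^ α := Real.rpow_le_rpow_of_exponent_ge (by linarith) hx2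
          ((le_abs_self α).trans hm)
    · calc (2 : ℝ) ^ (-|β|) ≤ (1 + x) ^ (-|β|) :=
          Real.rpow_le_rpow_of_nonpos (by linarith) hx4 (by simp)
        _ ≤ (1 + x) ^ β := Real.rpow_le_rpow_of_exponent_le hx3 (neg_abs_le β)
  have hint : IntervalIntegrable (fun x => weight α β x • (jacobiPoly α β n).eval x ^ 2)
      volume (-1) 1 := by
    refine (intervalIntegrable_weight hα hβ).mul_continuousOn ?_
    exact ((jacobiPoly α β n).continuous.pow 2).continuousOn
  rw [integral_weightMeasure]
  calc (1 / 4) ^ (m + 1) * 2 ^ (-|β|) / 4 * ((1 / B) ^ (m + 1)) ^ n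
      = ∫ x in (1 - 2 * τ)..(1 - τ), τ ^ m * 2 ^ (-|β|) * (1 / 4) := by
        rw [intervalIntegral.integral_const, hτ]
        simp only [smul_eq_mul, one_div, mul_inv, inv_pow, mul_pow]
        rw [pow_succ (4 : ℝ), ← pow_mul, pow_right_comm, ← pow_mul]
        field_simp
        ring
    _ ≤ ∫ x in (1 - 2 * τ)..(1 - τ), weight α β x • (jacobiPoly α β n).eval x ^ 2 := by
        refine intervalIntegral.integral_mono_on (by linarith) (by simp) ?_ fun x hx => ?_
        · refine hint.mono_set ?_
          rw [uIcc_of_le (by linarith), uIcc_of_le (by norm_num)]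
          exact Icc_subset_Icc (by linarith) (by linarith)
        · rw [smul_eq_mul]
          have := weight_nonneg (α := α) (β := β)
            (show x ∈ I from ⟨by linarith [hx.1], by linarith [hx.2]⟩)
          exact mul_le_mul (hw x hx) (hlow x hx) (by norm_num) this
    _ ≤ ∫ x in (-1 : ℝ)..1, weight α β x • (jacobiPoly α β n).eval x ^ 2 := by
        refine intervalIntegral.integral_mono_interval (by linarith) (by linarith) (by linarith)
          ?_ hint
        filter_upwards [ae_restrict_mem measurableSet_Ioc] with x hx
        exact mul_nonneg (weight_nonneg ⟨hx.1.le, hx.2⟩) (sq_nonneg _)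

lemma integral_jacobiPoly_mul (hα : -1 < α) (hβ : -1 < β) {m n : ℕ} (hmn : m ≠ n) :
    ∫ x, (jacobiPoly α β m).eval x * (jacobiPoly α β n).eval x ∂(weightMeasure α β) = 0 := by
  have h := integral_op_mul (c := 0) hα hβ (isEigenpair_jacobiPoly hα hβ m).contDiffOn
    (isEigenpair_jacobiPoly hα hβ n).contDiffOn
  have h1 : ∀ᵐ x ∂(weightMeasure α β),
      op 0 α β (fun x => (jacobiPoly α β m).eval x) x * (jacobiPoly α β n).eval x
        = -jacobiEigenvalue α β m * ((jacobiPoly α β m).eval x * (jacobiPoly α β n).eval x) := by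
    filter_upwards [ae_mem_I α β] with x hx
    rw [op_zero_jacobiPoly hα _ hx]
    ring
  have h2 : ∀ᵐ x ∂(weightMeasure α β),
      (jacobiPoly α β m).eval x * op 0 α β (fun x => (jacobiPoly α β n).eval x) x
        = -jacobiEigenvalue α β n * ((jacobiPoly α β m).eval x * (jacobiPoly α β n).eval x) := by
    filter_upwards [ae_mem_I α β] with x hx
    rw [op_zero_jacobiPoly hα _ hx]
    ring
  rw [integral_congr_ae h1, integral_congr_ae h2, integral_const_mul, integral_const_mul] at h
  have hne := (jacobiEigenvalue_strictMono hα hβ).injective.ne hmn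
  have : (jacobiEigenvalue α β n - jacobiEigenvalue α β m)
      * ∫ x, (jacobiPoly α β m).eval x * (jacobiPoly α β n).eval x ∂(weightMeasure α β) = 0 := by
    linear_combination h
  exact (mul_eq_zero.1 this).resolve_left (sub_ne_zero.2 hne.symm)

lemma mem_span_jacobiPoly (hα : -1 < α) (hβ : -1 < β) (m : ℕ) {p : ℝ[X]} (hp : p.degree < m) :
    p ∈ Submodule.span ℝ (jacobiPoly α β '' Set.Iio m) := by
  have := (jacobiSequence hα hβ).span_degreeLT (m := m) fun i _ =>
    (leadingCoeff_ne_zero.2 ((jacobiSequence hα hβ).ne_zero i)).isUnit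
  rw [← mem_degreeLT, ← this] at hp
  exact hp

end Jacobi

end PerturbedJacobi
namespace PerturbedJacobi

/-! ### Hilbert bases of the weighted `L²` space -/

section HilbertBasis

variable {α β : ℝ}

lemma inner_eq_integral {𝕜 : Type*} [RCLike 𝕜] {f g : Lp 𝕜 2 (weightMeasure α β)} {u v : ℝ → 𝕜}
    (hu : f =ᵐ[weightMeasure α β] u) (hv : g =ᵐ[weightMeasure α β] v) :
    inner 𝕜 f g = ∫ x, v x * (starRingEnd 𝕜) (u x) ∂(weightMeasure α β) := by
  rw [L2.inner_def]
  refine integral_congr_ae ?_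
  filter_upwards [hu, hv] with x h1 h2
  rw [h1, h2, RCLike.inner_apply]

lemma real_inner_eq_integral {f g : Lp ℝ 2 (weightMeasure α β)} {u v : ℝ → ℝ}
    (hu : f =ᵐ[weightMeasure α β] u) (hv : g =ᵐ[weightMeasure α β] v) :
    inner ℝ f g = ∫ x, u x * v x ∂(weightMeasure α β) := by
  rw [inner_eq_integral hu hv]
  simp [mul_comm]

/-- A real orthonormal family that is complete for real functions is a Hilbert basis over `𝕜`: the
real and imaginary parts of a function orthogonal to the family are orthogonal to it. -/
lemma exists_hilbertBasis (𝕜 : Type*) [RCLike 𝕜] (hα : -1 < α) (hβ : -1 < β) (ψ : ℕ → ℝ → ℝ)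
    (hc : ∀ n, ContinuousOn (ψ n) I)
    (ho : ∀ m n, ∫ x, ψ m x * ψ n x ∂(weightMeasure α β) = if m = n then 1 else 0)
    (hcomp : ∀ g : ℝ → ℝ, MemLp g 2 (weightMeasure α β) →
      (∀ n, ∫ x, ψ n x * g x ∂(weightMeasure α β) = 0) → g =ᵐ[weightMeasure α β] 0) :
    ∃ b : HilbertBasis ℕ 𝕜 (Lp 𝕜 2 (weightMeasure α β)),
      ∀ n, (b n : ℝ → 𝕜) =ᵐ[weightMeasure α β] fun x => (ψ n x : 𝕜) := by
  have hm : ∀ n, MemLp (fun x => (ψ n x : 𝕜)) 2 (weightMeasure α β) := fun n =>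
    memLp_of_continuousOn hα hβ (RCLike.continuous_ofReal.comp_continuousOn (hc n)) 2
  have hae : ∀ n, ((hm n).toLp _ : ℝ → 𝕜) =ᵐ[weightMeasure α β] fun x => (ψ n x : 𝕜) := fun n =>
    (hm n).coeFn_toLp
  have hv : Orthonormal 𝕜 fun n => (hm n).toLp _ := by
    refine orthonormal_iff_ite.2 fun m n => ?_
    rw [inner_eq_integral (hae m) (hae n)]
    simp only [RCLike.conj_ofReal, ← RCLike.ofReal_mul]
    rw [integral_ofReal, ho]
    by_cases h : m = n
    · simp [h]
    · simp [h, Ne.symm h]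
  refine ⟨HilbertBasis.mkOfOrthogonalEqBot hv ?_, fun n => ?_⟩
  · rw [eq_bot_iff]
    intro g hg
    have hgm := Lp.memLp g
    have h0 : ∀ n, ∫ x, (g x : 𝕜) * (ψ n x : 𝕜) ∂(weightMeasure α β) = 0 := fun n => by
      have := (Submodule.mem_orthogonal _ _).1 hg _ (Submodule.subset_span ⟨n, rfl⟩)
      rw [inner_eq_integral (hae n) (Filter.EventuallyEq.refl _ _)] at this
      simpa using this
    have hint : ∀ n, Integrable (fun x => (g x : 𝕜) * (ψ n x : 𝕜)) (weightMeasure α β) :=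
      fun n => hgm.integrable_mul (hm n)
    have hre := hcomp (fun x => RCLike.re (g x)) hgm.re fun n => by
      have := congrArg RCLike.re (h0 n)
      rw [← integral_re (hint n)] at this
      simpa [mul_comm] using this
    have him := hcomp (fun x => RCLike.im (g x)) hgm.im fun n => by
      have := congrArg RCLike.im (h0 n)
      rw [← integral_im (hint n)] at this
      simpa [mul_comm] using this
    rw [Submodule.mem_bot, Lp.eq_zero_iff_ae_eq_zero]
    filter_upwards [hre, him] with x h1 h2
    exact RCLike.ext (by simpa using h1) (by simpa using h2)
  · rw [HilbertBasis.coe_mkOfOrthogonalEqBot]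
    exact hae n

/-- The Jacobi polynomials, normalized in `L²(weightMeasure α β)`. -/
noncomputable def jacobiFun (α β : ℝ) (n : ℕ) (x : ℝ) : ℝ :=
  (√(∫ y, (jacobiPoly α β n).eval y ^ 2 ∂(weightMeasure α β)))⁻¹ * (jacobiPoly α β n).eval x

lemma integral_jacobiPoly_sq_pos (hα : -1 < α) (hβ : -1 < β) (n : ℕ) :
    0 < ∫ y, (jacobiPoly α β n).eval y ^ 2 ∂(weightMeasure α β) := by
  obtain ⟨b, hb, a, ha, h⟩ := le_integral_jacobiPoly_sq hα hβ
  exact lt_of_lt_of_le (by positivity) (h n)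

lemma contDiff_jacobiFun (n : ℕ) : ContDiff ℝ 2 (jacobiFun α β n) :=
  contDiff_const.mul (contDiff_eval _)

lemma jacobiFun_orthonormal (hα : -1 < α) (hβ : -1 < β) (m n : ℕ) :
    ∫ x, jacobiFun α β m x * jacobiFun α β n x ∂(weightMeasure α β) = if m = n then 1 else 0 := by
  simp only [jacobiFun]
  simp only [mul_mul_mul_comm _ (Polynomial.eval _ (jacobiPoly α β m)), integral_const_mul]
  split_ifs with h
  · subst h
    have := integral_jacobiPoly_sq_pos hα hβ m
    simp only [← pow_two, inv_pow]
    rw [Real.sq_sqrt this.le, inv_mul_cancel₀ this.ne']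
  · rw [integral_jacobiPoly_mul hα hβ h, mul_zero]

lemma jacobiPoly_eq_smul_jacobiFun (hα : -1 < α) (hβ : -1 < β) (n : ℕ) (x : ℝ) :
    (jacobiPoly α β n).eval x
      = √(∫ y, (jacobiPoly α β n).eval y ^ 2 ∂(weightMeasure α β)) * jacobiFun α β n x := by
  have := integral_jacobiPoly_sq_pos hα hβ n
  rw [jacobiFun, mul_inv_cancel_left₀ (Real.sqrt_pos.2 this).ne']

/-- A linear functional vanishing on `P_0, …, P_{m-1}` vanishes on the polynomials of degree
less than `m`. -/
lemma integral_polynomial_mul_eq_zero (hα : -1 < α) (hβ : -1 < β) {g : ℝ → ℝ}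
    (hg : MemLp g 2 (weightMeasure α β)) {m : ℕ}
    (h : ∀ k < m, ∫ x, jacobiFun α β k x * g x ∂(weightMeasure α β) = 0) {p : Polynomial ℝ}
    (hp : p.degree < m) : ∫ x, p.eval x * g x ∂(weightMeasure α β) = 0 := by
  have hint : ∀ q : Polynomial ℝ, Integrable (fun x => q.eval x * g x) (weightMeasure α β) :=
    fun q => (memLp_of_continuousOn hα hβ q.continuous.continuousOn 2).integrable_mul hg
  have hspan := mem_span_jacobiPoly hα hβ m hp
  clear hp
  induction hspan using Submodule.span_induction with
  | mem q hq =>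
    obtain ⟨k, hk, rfl⟩ := hq
    have e1 : (fun x => (jacobiPoly α β k).eval x * g x) = fun x =>
        √(∫ y, (jacobiPoly α β k).eval y ^ 2 ∂(weightMeasure α β)) * (jacobiFun α β k x * g x) := by
      ext x
      rw [← mul_assoc, ← jacobiPoly_eq_smul_jacobiFun hα hβ k]
    rw [e1, integral_const_mul, h k hk, mul_zero]
  | zero => simp
  | add q r _ _ hq hr =>
    simp only [Polynomial.eval_add, add_mul]
    rw [integral_add (hint q) (hint r), hq, hr, add_zero]
  | smul t q _ hq =>
    simp only [Polynomial.eval_smul, smul_eq_mul, mul_assoc]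
    rw [integral_const_mul, hq, mul_zero]

lemma ae_eq_zero_of_forall_integral_jacobiFun (hα : -1 < α) (hβ : -1 < β) {g : ℝ → ℝ}
    (hg : MemLp g 2 (weightMeasure α β))
    (h : ∀ n, ∫ x, jacobiFun α β n x * g x ∂(weightMeasure α β) = 0) :
    g =ᵐ[weightMeasure α β] 0 :=
  ae_eq_zero_of_forall_integral_polynomial hα hβ hg fun p =>
    integral_polynomial_mul_eq_zero hα hβ hg (m := p.natDegree + 1) (fun k _ => h k)
      (p.degree_le_natDegree.trans_lt (by exact_mod_cast p.natDegree.lt_succ_self))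

lemma exists_jacobi_hilbertBasis (hα : -1 < α) (hβ : -1 < β) :
    ∃ b : HilbertBasis ℕ ℝ (Lp ℝ 2 (weightMeasure α β)),
      ∀ n, (b n : ℝ → ℝ) =ᵐ[weightMeasure α β] jacobiFun α β n :=
  exists_hilbertBasis ℝ hα hβ _ (fun n => (contDiff_jacobiFun n).continuous.continuousOn)
    (jacobiFun_orthonormal hα hβ) fun _ hg h => ae_eq_zero_of_forall_integral_jacobiFun hα hβ hg h

/-- Multiplication by `x²` as a bounded operator on `L²(weightMeasure α β)`. -/
lemma exists_sq_mul_operator (α β : ℝ) :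
    ∃ M : Lp ℝ 2 (weightMeasure α β) →L[ℝ] Lp ℝ 2 (weightMeasure α β), ‖M‖ ≤ 1 ∧
      ∀ f, (M f : ℝ → ℝ) =ᵐ[weightMeasure α β] fun x => x ^ 2 * f x := by
  have hle : ∀ f : ℝ → ℝ, ∀ᵐ x ∂(weightMeasure α β), ‖x ^ 2 * f x‖ ≤ ‖f x‖ := fun f => by
    filter_upwards [ae_mem_I α β] with x hx
    rw [norm_mul, Real.norm_eq_abs, abs_of_nonneg (sq_nonneg x)]
    refine mul_le_of_le_one_left (norm_nonneg _) ?_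
    rw [sq_le_one_iff_abs_le_one]
    exact abs_le.2 hx
  have hm : ∀ f : Lp ℝ 2 (weightMeasure α β),
      MemLp (fun x => x ^ 2 * f x) 2 (weightMeasure α β) := fun f => by
    refine (Lp.memLp f).mono ?_ (hle f)
    exact (by fun_prop : Measurable fun x : ℝ => x ^ 2).aestronglyMeasurable.mul
      (Lp.aestronglyMeasurable f)
  let L : Lp ℝ 2 (weightMeasure α β) →ₗ[ℝ] Lp ℝ 2 (weightMeasure α β) :=
    { toFun := fun f => (hm f).toLp _
      map_add' := fun f g => by
        refine Lp.ext ?_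
        filter_upwards [(hm (f + g)).coeFn_toLp, (hm f).coeFn_toLp, (hm g).coeFn_toLp,
          Lp.coeFn_add f g, Lp.coeFn_add ((hm f).toLp _) ((hm g).toLp _)] with x h1 h2 h3 h4 h5
        rw [h1, h5, Pi.add_apply, h2, h3, h4, Pi.add_apply, mul_add]
      map_smul' := fun r f => by
        refine Lp.ext ?_
        filter_upwards [(hm (r • f)).coeFn_toLp, (hm f).coeFn_toLp, Lp.coeFn_smul r f,
          Lp.coeFn_smul r ((hm f).toLp _)] with x h1 h2 h3 h4
        rw [h1, RingHom.id_apply, h4, Pi.smul_apply, h2, h3, Pi.smul_apply, smul_eq_mul,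
          smul_eq_mul, mul_left_comm] }
  refine ⟨L.mkContinuous 1 fun f => ?_, L.mkContinuous_norm_le zero_le_one _, fun f =>
    (hm f).coeFn_toLp⟩
  rw [one_mul]
  refine Lp.norm_le_norm_of_ae_le ?_
  filter_upwards [(hm f).coeFn_toLp, hle f] with x h1 h2
  rwa [show (L f : ℝ → ℝ) x = _ from h1]

end HilbertBasis

end PerturbedJacobi
namespace PerturbedJacobi

/-! ### Regularity of weak eigenfunctions -/

section Regularity

variable {α β : ℝ}

/-- A bounded solution of a recurrence whose diagonal tends to infinity, and in which the `n`-th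
equation does not involve the terms before the `(n - 2)`-nd, decays faster than any
geometric sequence. -/
lemma exists_forall_abs_le_mul_pow {a d : ℕ → ℝ} {A C : ℝ} (hA : ∀ n, |a n| ≤ A)
    (hd : Filter.Tendsto d Filter.atTop Filter.atTop)
    (h : ∀ n B, (∀ m, n ≤ m + 2 → |a m| ≤ B) → |d n * a n| ≤ C * B) {r : ℝ} (hr : 0 < r)
    (hr1 : r ≤ 1) : ∃ K, 0 ≤ K ∧ ∀ n, |a n| ≤ K * r ^ n := by
  have hA0 : 0 ≤ A := (abs_nonneg _).trans (hA 0)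
  obtain ⟨N, hN⟩ := Filter.eventually_atTop.1
    (hd.eventually_ge_atTop ((|C| + 1) / r ^ 2))
  have hstep : ∀ n, N ≤ n → ∀ B, (∀ m, n ≤ m + 2 → |a m| ≤ B) → |a n| ≤ r ^ 2 * B := by
    intro n hn B hB
    have hB0 : 0 ≤ B := (abs_nonneg _).trans (hB n (by omega))
    have h1 := h n B hB
    have h2 := hN n hn
    have h3 : (|C| + 1) / r ^ 2 * |a n| ≤ (|C| + 1) * B := by
      calc _ ≤ d n * |a n| := by gcongr
        _ ≤ |d n * a n| := by
          rw [abs_mul]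
          gcongr
          exact le_abs_self _
        _ ≤ C * B := h1
        _ ≤ (|C| + 1) * B := by
          gcongr
          linarith [le_abs_self C]
    rw [div_mul_eq_mul_div, div_le_iff₀ (by positivity), mul_assoc] at h3
    have := le_of_mul_le_mul_left h3 (by positivity)
    linarith
  have hdec : ∀ j n, N + 2 * j ≤ n ∨ j = 0 → |a n| ≤ A * (r ^ 2) ^ j := by
    intro j
    induction j with
    | zero => intro n _; simpa using hA n
    | succ j ih =>
      intro n hn
      have hn' : N + 2 * (j + 1) ≤ n := hn.resolve_right (by omega)
      refine (hstep n (by omega) (A * (r ^ 2) ^ j) fun m hm => ih m (Or.inl (by omega))).trans ?_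
      rw [pow_succ (r ^ 2)]
      linarith
  refine ⟨A / r ^ (N + 1), by positivity, fun n => ?_⟩
  refine (hdec ((n - N) / 2) n (by omega)).trans ?_
  rw [div_mul_eq_mul_div, le_div_iff₀ (by positivity), mul_assoc, ← pow_mul, ← pow_add]
  exact mul_le_mul_of_nonneg_left (pow_le_pow_of_le_one hr.le hr1 (by omega)) hA0

lemma contDiff_of_analytic {ψ : ℝ → ℝ} (hψ : AnalyticOnNhd ℝ ψ univ) : ContDiff ℝ 2 ψ :=
  contDiffOn_univ.1 (hψ.contDiffOn uniqueDiffOn_univ)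

lemma integral_sq_mul_jacobiFun_mul (hα : -1 < α) (hβ : -1 < β) {m n : ℕ} (h : m + 2 < n) :
    ∫ x, x ^ 2 * jacobiFun α β m x * jacobiFun α β n x ∂(weightMeasure α β) = 0 := by
  have hdeg : (Polynomial.X ^ 2 * jacobiPoly α β m).degree < (n : WithBot ℕ) := by
    rw [Polynomial.degree_mul, Polynomial.degree_X_pow, degree_jacobiPoly hα hβ]
    exact_mod_cast (by omega : 2 + m < n)
  have := integral_polynomial_mul_eq_zero hα hβ
    (memLp_of_continuousOn hα hβ (contDiff_jacobiFun n).continuous.continuousOn 2) (m := n)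
    (fun k hk => by rw [jacobiFun_orthonormal hα hβ, if_neg hk.ne]) hdeg
  simp only [Polynomial.eval_mul, Polynomial.eval_pow, Polynomial.eval_X] at this
  calc _ = ∫ x, (√(∫ y, (jacobiPoly α β m).eval y ^ 2 ∂(weightMeasure α β)))⁻¹
        * (x ^ 2 * (jacobiPoly α β m).eval x * jacobiFun α β n x) ∂(weightMeasure α β) := by
        refine integral_congr_ae (Filter.Eventually.of_forall fun x => ?_)
        simp only [jacobiFun]
        ring
    _ = 0 := by rw [integral_const_mul, this, mul_zero]

/-- Multiplication by `x²` is a band matrix in the basis of Jacobi polynomials. -/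
lemma abs_integral_sq_mul_jacobiFun_mul_le (hα : -1 < α) (hβ : -1 < β) {f : ℝ → ℝ}
    (hf : MemLp f 2 (weightMeasure α β)) (n : ℕ) (B : ℝ)
    (hB : ∀ m, n ≤ m + 2 → |∫ x, jacobiFun α β m x * f x ∂(weightMeasure α β)| ≤ B) :
    |∫ x, x ^ 2 * jacobiFun α β n x * f x ∂(weightMeasure α β)| ≤ 5 * B := by
  obtain ⟨e, he⟩ := exists_jacobi_hilbertBasis hα hβ
  obtain ⟨M, hM1, hM⟩ := exists_sq_mul_operator α β
  set F := hf.toLp f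
  have hF := hf.coeFn_toLp
  have hMe : ∀ k, (M (e k) : ℝ → ℝ) =ᵐ[weightMeasure α β] fun x => x ^ 2 * jacobiFun α β k x :=
    fun k => by
      filter_upwards [hM (e k), he k] with x h1 h2
      rw [h1, h2]
  have hB0 : 0 ≤ B := (abs_nonneg _).trans (hB n (by omega))
  rw [← real_inner_eq_integral (hMe n) hF, ← e.tsum_inner_mul_inner]
  have hband : ∀ m ∉ Finset.Icc (n - 2) (n + 2), inner ℝ (M (e n)) (e m) * inner ℝ (e m) F = 0 := by
    intro m hm
    rw [Finset.mem_Icc, not_and_or, not_le, not_le] at hm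
    rw [real_inner_eq_integral (hMe n) (he m)]
    rcases hm with hm | hm
    · have := integral_sq_mul_jacobiFun_mul hα hβ (show m + 2 < n by omega)
      simp only [mul_right_comm _ (jacobiFun α β n _) (jacobiFun α β m _), this, zero_mul]
    · rw [integral_sq_mul_jacobiFun_mul hα hβ hm, zero_mul]
  rw [tsum_eq_sum hband]
  refine (Finset.abs_sum_le_sum_abs _ _).trans ?_
  calc _ ≤ ∑ m ∈ Finset.Icc (n - 2) (n + 2), B := by
        refine Finset.sum_le_sum fun m hm => ?_
        rw [Finset.mem_Icc] at hm
        rw [abs_mul]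
        have h1 : |inner ℝ (M (e n)) (e m)| ≤ 1 := by
          refine (abs_real_inner_le_norm _ _).trans ?_
          have := M.le_opNorm (e n)
          rw [e.orthonormal.1 n] at this
          rw [e.orthonormal.1 m]
          linarith
        have h2 : |inner ℝ (e m) F| ≤ B := by
          rw [real_inner_eq_integral (he m) hF]
          exact hB m (by omega)
        calc _ ≤ 1 * B := mul_le_mul h1 h2 (abs_nonneg _) zero_le_one
          _ = B := one_mul _
    _ ≤ 5 * B := by
        rw [Finset.sum_const, nsmul_eq_mul, Nat.card_Icc]
        gcongr
        exact_mod_cast (by omega : n + 2 + 1 - (n - 2) ≤ 5)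

/-- A weak eigenfunction has superexponentially small Jacobi coefficients, so its Jacobi series
converges locally uniformly on the complex plane. -/
lemma exists_analytic_of_weak (hα : -1 < α) (hβ : -1 < β) {c χ : ℝ} {f : ℝ → ℝ}
    (hf : MemLp f 2 (weightMeasure α β))
    (h : ∀ n, (jacobiEigenvalue α β n - χ) * ∫ x, jacobiFun α β n x * f x ∂(weightMeasure α β)
      = -c ^ 2 * ∫ x, x ^ 2 * jacobiFun α β n x * f x ∂(weightMeasure α β)) :
    ∃ ψ : ℝ → ℝ, AnalyticOnNhd ℝ ψ univ ∧ f =ᵐ[weightMeasure α β] ψ := by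
  obtain ⟨e, he⟩ := exists_jacobi_hilbertBasis hα hβ
  set a : ℕ → ℝ := fun n => ∫ x, jacobiFun α β n x * f x ∂(weightMeasure α β) with ha
  have hF := hf.coeFn_toLp
  have haA : ∀ n, |a n| ≤ ‖hf.toLp f‖ := fun n => by
    rw [ha]
    simp only
    rw [← real_inner_eq_integral (he n) hF]
    refine (abs_real_inner_le_norm _ _).trans ?_
    rw [e.orthonormal.1 n, one_mul]
  have hdec : ∀ r : ℝ, 0 < r → r ≤ 1 → ∃ K, 0 ≤ K ∧ ∀ n, |a n| ≤ K * r ^ n := fun r hr hr1 =>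
    exists_forall_abs_le_mul_pow (d := fun n => jacobiEigenvalue α β n - χ) (C := c ^ 2 * 5) haA
      (Filter.tendsto_atTop_add_const_right _ (-χ) (tendsto_jacobiEigenvalue α β))
      (fun n B hB => by
        rw [h n, abs_mul, abs_neg, abs_of_nonneg (sq_nonneg c), mul_assoc]
        gcongr
        exact abs_integral_sq_mul_jacobiFun_mul_le hα hβ hf n B hB) hr hr1
  set N : ℕ → ℝ := fun n => (√(∫ y, (jacobiPoly α β n).eval y ^ 2 ∂(weightMeasure α β)))⁻¹ with hN
  obtain ⟨b, hb, b', hb', hbn⟩ := le_integral_jacobiPoly_sq hα hβ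
  have hNle : ∀ n, |N n| ≤ (√b')⁻¹ * (√b)⁻¹ ^ n := fun n => by
    rw [hN]
    simp only
    rw [abs_of_nonneg (by positivity), inv_pow, ← mul_inv]
    refine inv_anti₀ (by positivity) ?_
    refine Real.le_sqrt_of_sq_le ?_
    rw [mul_pow, Real.sq_sqrt hb'.le, ← pow_mul, mul_comm n 2, pow_mul, Real.sq_sqrt hb.le]
    exact hbn n
  set G : ℕ → ℂ → ℂ := fun n z => ((a n * N n : ℝ) : ℂ) * Polynomial.aeval z (jacobiPoly α β n)
    with hG
  have hbound : ∀ R : ℝ, ∃ K : ℝ, ∀ n z, ‖z‖ ≤ R → ‖G n z‖ ≤ K * (1 / 2) ^ n := fun R => by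
    obtain ⟨B, hB, hBn⟩ := norm_aeval_jacobiPoly_le hα hβ R
    set q := (√b)⁻¹ * B + 1 with hq
    have hq0 : 0 < q := by positivity
    have hq1 : 1 ≤ q := by rw [hq]; linarith [show 0 ≤ (√b)⁻¹ * B by positivity]
    obtain ⟨K, hK, hKn⟩ := hdec (1 / 2 / q) (by positivity) (by
      rw [div_le_one hq0]; linarith)
    refine ⟨K * (√b')⁻¹, fun n z hz => ?_⟩
    rw [hG]
    simp only
    rw [norm_mul, Complex.norm_real, Real.norm_eq_abs, abs_mul]
    calc |a n| * |N n| * ‖Polynomial.aeval z (jacobiPoly α β n)‖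
        ≤ K * (1 / 2 / q) ^ n * ((√b')⁻¹ * (√b)⁻¹ ^ n) * B ^ n := by
          gcongr
          · exact hKn n
          · exact hNle n
          · exact hBn n z hz
      _ = K * (√b')⁻¹ * ((1 / 2) ^ n * (((√b)⁻¹ * B) / q) ^ n) := by
          rw [div_pow (1 / 2 : ℝ) q, div_pow _ q, mul_pow (√b)⁻¹ B]; ring
      _ ≤ K * (√b')⁻¹ * ((1 / 2) ^ n * 1) := by
          gcongr
          refine pow_le_one₀ (by positivity) ?_
          rw [div_le_one hq0, hq]
          linarith
      _ = _ := by ring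
  have hsum : ∀ K : ℝ, Summable fun n : ℕ => K * (1 / 2 : ℝ) ^ n := fun K =>
    summable_geometric_two.mul_left K
  have hdiff : Differentiable ℂ fun z => ∑' n, G n z := fun z => by
    obtain ⟨K, hK⟩ := hbound (‖z‖ + 1)
    have := Complex.differentiableOn_tsum_of_summable_norm (F := G)
      (U := Metric.ball 0 (‖z‖ + 1)) (hsum K) (fun n => ?_) Metric.isOpen_ball fun n w hw =>
        hK n w (by simpa using (mem_ball_zero_iff.1 hw).le)
    · exact this.differentiableAt (Metric.isOpen_ball.mem_nhds (by simp))
    · exact ((Polynomial.differentiable_aeval (𝕜 := ℂ) _).const_mul _).differentiableOn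
  have hGreal : ∀ n (x : ℝ), G n x = ((a n * jacobiFun α β n x : ℝ) : ℂ) := fun n x => by
    have : Polynomial.aeval (x : ℂ) (jacobiPoly α β n) = (((jacobiPoly α β n).eval x : ℝ) : ℂ) := by
      rw [← Complex.coe_algebraMap, Polynomial.aeval_algebraMap_apply,
        Polynomial.coe_aeval_eq_eval]
    rw [hG]
    simp only
    rw [this, ← Complex.ofReal_mul, jacobiFun, mul_assoc]
  refine ⟨fun x => (∑' n, G n x).re, fun x _ => (hdiff.analyticAt x).re_ofReal, ?_⟩
  have hψ : ∀ x : ℝ, (∑' n, G n x).re = ∑' n, a n * jacobiFun α β n x := fun x => by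
    simp only [hGreal]
    rw [← Complex.ofReal_tsum, Complex.ofReal_re]
  simp only [hψ]
  have hcont : Continuous fun x : ℝ => ∑' n, a n * jacobiFun α β n x := by
    simp only [← hψ]
    exact Complex.continuous_re.comp (hdiff.continuous.comp Complex.continuous_ofReal)
  obtain ⟨K, hK⟩ := hbound 1
  have hK' : ∀ n, ∀ x ∈ I, ‖a n * jacobiFun α β n x‖ ≤ K * (1 / 2) ^ n := fun n x hx => by
    rw [← Complex.norm_real, ← hGreal]
    exact hK n x (by rw [Complex.norm_real]; exact abs_le.2 hx)
  have hψm := memLp_of_continuousOn hα hβ hcont.continuousOn 2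
  have hj : ∀ n, Continuous (jacobiFun α β n) := fun n => (contDiff_jacobiFun n).continuous
  have hz := ae_eq_zero_of_forall_integral_jacobiFun hα hβ (hf.sub hψm) fun n => by
    have i1 : Integrable (fun x => jacobiFun α β n x * f x) (weightMeasure α β) :=
      (memLp_of_continuousOn hα hβ (hj n).continuousOn 2).integrable_mul hf
    have i2 : Integrable (fun x => jacobiFun α β n x * ∑' m, a m * jacobiFun α β m x)
        (weightMeasure α β) := integrable_of_continuousOn hα hβ ((hj n).mul hcont).continuousOn
    simp only [Pi.sub_apply, mul_sub]
    rw [integral_sub i1 i2, sub_eq_zero]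
    have i3 : ∀ m, Integrable (fun x => jacobiFun α β n x * (a m * jacobiFun α β m x))
        (weightMeasure α β) := fun m =>
      integrable_of_continuousOn hα hβ (by fun_prop)
    have i4 : ∀ m, ∫ x, ‖jacobiFun α β n x * (a m * jacobiFun α β m x)‖ ∂(weightMeasure α β)
        ≤ (∫ x, ‖jacobiFun α β n x‖ ∂(weightMeasure α β)) * K * (1 / 2) ^ m := fun m => by
      rw [mul_assoc, ← integral_mul_const]
      refine integral_mono_ae (i3 m).norm ?_ ?_
      · exact integrable_of_continuousOn hα hβ (by fun_prop)
      · filter_upwards [ae_mem_I α β] with x hx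
        rw [norm_mul]
        exact mul_le_mul_of_nonneg_left (hK' m x hx) (norm_nonneg _)
    have := hasSum_integral_of_summable_integral_norm i3
      ((hsum _).of_nonneg_of_le (fun m => integral_nonneg fun _ => norm_nonneg _) i4)
    simp only [tsum_mul_left] at this
    rw [← this.tsum_eq, tsum_eq_single n]
    · calc a n = a n * ∫ x, jacobiFun α β n x * jacobiFun α β n x ∂(weightMeasure α β) := by
            rw [jacobiFun_orthonormal hα hβ, if_pos rfl, mul_one]
        _ = _ := by
            rw [← integral_const_mul]
            simp only [mul_left_comm]
    · intro m hm
      simp only [mul_left_comm _ (a m)]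
      rw [integral_const_mul, jacobiFun_orthonormal hα hβ, if_neg hm.symm, mul_zero]
  filter_upwards [hz] with x hx
  exact sub_eq_zero.1 hx

lemma op_jacobiFun (hα : -1 < α) (c : ℝ) (n : ℕ) {x : ℝ} (hx : x ∈ I) :
    op c α β (jacobiFun α β n) x
      = -jacobiEigenvalue α β n * jacobiFun α β n x - c ^ 2 * x ^ 2 * jacobiFun α β n x := by
  have h := op_zero_jacobiPoly (β := β) hα n hx
  rw [op_eq_deriv (contDiff_eval _) hx] at h
  rw [op_eq_deriv (contDiff_jacobiFun n) hx]
  have h1 : deriv (jacobiFun α β n) = fun x =>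
      (√(∫ y, (jacobiPoly α β n).eval y ^ 2 ∂(weightMeasure α β)))⁻¹
        * deriv (fun x => (jacobiPoly α β n).eval x) x := by
    ext x
    exact deriv_const_mul_field _
  rw [h1, deriv_const_mul_field, jacobiFun]
  linear_combination (√(∫ y, (jacobiPoly α β n).eval y ^ 2 ∂(weightMeasure α β)))⁻¹ * h

/-- Testing a function of class `C²` against a Jacobi polynomial. -/
lemma integral_jacobiFun_mul_op (hα : -1 < α) (hβ : -1 < β) (c : ℝ) {u : ℝ → ℝ}
    (hu : ContDiffOn ℝ 2 u I) (n : ℕ) :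
    ∫ x, jacobiFun α β n x * op c α β u x ∂(weightMeasure α β)
      = -jacobiEigenvalue α β n * ∫ x, jacobiFun α β n x * u x ∂(weightMeasure α β)
        - c ^ 2 * ∫ x, x ^ 2 * jacobiFun α β n x * u x ∂(weightMeasure α β) := by
  rw [← integral_op_mul hα hβ (contDiff_jacobiFun n).contDiffOn hu, ← integral_const_mul,
    ← integral_const_mul, ← integral_sub]
  · refine integral_congr_ae ?_
    filter_upwards [ae_mem_I α β] with x hx
    rw [op_jacobiFun hα c n hx]
    ring
  all_goals
    refine integrable_of_continuousOn hα hβ ?_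
    have h1 : ContinuousOn (jacobiFun α β n) I := (contDiff_jacobiFun n).continuous.continuousOn
    have h2 := hu.continuousOn
    fun_prop

/-- Weak eigenfunctions are restrictions of real-analytic eigenfunctions. -/
theorem exists_analytic_eigenfunction_of_weak (hα : -1 < α) (hβ : -1 < β) {c χ : ℝ} {f : ℝ → ℝ}
    (hf : MemLp f 2 (weightMeasure α β))
    (h : ∀ n, (jacobiEigenvalue α β n - χ) * ∫ x, jacobiFun α β n x * f x ∂(weightMeasure α β)
      = -c ^ 2 * ∫ x, x ^ 2 * jacobiFun α β n x * f x ∂(weightMeasure α β)) :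
    ∃ ψ : ℝ → ℝ, AnalyticOnNhd ℝ ψ univ ∧ f =ᵐ[weightMeasure α β] ψ ∧
      ∀ x ∈ I, -op c α β ψ x = χ * ψ x := by
  obtain ⟨ψ, hψ, hfψ⟩ := exists_analytic_of_weak hα hβ hf h
  refine ⟨ψ, hψ, hfψ, ?_⟩
  have hψ2 : ContDiffOn ℝ 2 ψ I := (contDiff_of_analytic hψ).contDiffOn
  have c1 : ContinuousOn (fun x => op c α β ψ x + χ * ψ x) I :=
    (continuousOn_op c α β hψ2).add (hψ2.continuousOn.const_mul χ)
  have hj : ∀ n, ContinuousOn (jacobiFun α β n) I :=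
    fun n => (contDiff_jacobiFun n).continuous.continuousOn
  have hz : (fun x => op c α β ψ x + χ * ψ x) =ᵐ[weightMeasure α β] 0 := by
    refine ae_eq_zero_of_forall_integral_jacobiFun hα hβ (memLp_of_continuousOn hα hβ c1 2)
      fun n => ?_
    have e1 : ∫ x, jacobiFun α β n x * f x ∂(weightMeasure α β)
        = ∫ x, jacobiFun α β n x * ψ x ∂(weightMeasure α β) := by
      refine integral_congr_ae ?_
      filter_upwards [hfψ] with x hx
      rw [hx]
    have e2 : ∫ x, x ^ 2 * jacobiFun α β n x * f x ∂(weightMeasure α β)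
        = ∫ x, x ^ 2 * jacobiFun α β n x * ψ x ∂(weightMeasure α β) := by
      refine integral_congr_ae ?_
      filter_upwards [hfψ] with x hx
      rw [hx]
    have hn := h n
    rw [e1, e2] at hn
    simp only [mul_add, mul_left_comm _ χ]
    rw [integral_add, integral_const_mul, integral_jacobiFun_mul_op hα hβ c hψ2]
    · linear_combination -hn
    · exact integrable_of_continuousOn hα hβ ((hj n).mul (continuousOn_op c α β hψ2))
    · exact integrable_of_continuousOn hα hβ (((hj n).mul hψ2.continuousOn).const_mul χ)
  intro x hx
  have := eqOn_of_ae_eq c1 continuousOn_const hz hx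
  exact neg_eq_of_add_eq_zero_right this

lemma IsEigenpair.exists_analytic (hα : -1 < α) (hβ : -1 < β) {c χ : ℝ} {f : ℝ → ℝ}
    (hf : IsEigenpair c α β χ f) :
    ∃ ψ : ℝ → ℝ, AnalyticOnNhd ℝ ψ univ ∧ EqOn f ψ I ∧ IsEigenpair c α β χ ψ := by
  have hm := memLp_of_continuousOn hα hβ hf.contDiffOn.continuousOn 2
  obtain ⟨ψ, hψ, hfψ, hop⟩ := exists_analytic_eigenfunction_of_weak hα hβ (c := c) (χ := χ) hm
    fun n => by
      have h1 := integral_jacobiFun_mul_op hα hβ c hf.contDiffOn n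
      have h2 : ∫ x, jacobiFun α β n x * op c α β f x ∂(weightMeasure α β)
          = -χ * ∫ x, jacobiFun α β n x * f x ∂(weightMeasure α β) := by
        rw [← integral_const_mul]
        refine integral_congr_ae ?_
        filter_upwards [ae_mem_I α β] with x hx
        rw [← neg_neg (op c α β f x), hf.eigen x hx]
        ring
      rw [h2] at h1
      linear_combination h1
  have hψ2 : ContDiffOn ℝ 2 ψ I := (contDiff_of_analytic hψ).contDiffOn
  have heq := eqOn_of_ae_eq hf.contDiffOn.continuousOn hψ2.continuousOn hfψ
  obtain ⟨x, hx, hne⟩ := hf.ne_zero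
  exact ⟨ψ, hψ, heq, hψ2, ⟨x, hx, by rwa [← heq hx]⟩, hop⟩

/-- The eigenfunctions are complete in `L²(weightMeasure α β)`. -/
theorem ae_eq_zero_of_forall_integral_eigenfunction (hα : -1 < α) (hβ : -1 < β) (c : ℝ)
    {g : ℝ → ℝ} (hg : MemLp g 2 (weightMeasure α β))
    (h : ∀ χ ψ, IsEigenpair c α β χ ψ → ∫ x, ψ x * g x ∂(weightMeasure α β) = 0) :
    g =ᵐ[weightMeasure α β] 0 := by
  obtain ⟨e, he⟩ := exists_jacobi_hilbertBasis hα hβ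
  obtain ⟨M, hM1, hM⟩ := exists_sq_mul_operator α β
  have hgL := hg.coeFn_toLp
  suffices hg.toLp g = 0 by
    rw [Lp.eq_zero_iff_ae_eq_zero] at this
    exact hgL.symm.trans this
  have hMi : ∀ (u v : Lp ℝ 2 (weightMeasure α β)),
      inner ℝ u (M v) = ∫ x, x ^ 2 * u x * v x ∂(weightMeasure α β) := fun u v => by
    rw [real_inner_eq_integral (Filter.EventuallyEq.refl _ _) (hM v)]
    refine integral_congr_ae (Filter.Eventually.of_forall fun x => ?_)
    ring
  refine eq_zero_of_forall_inner_weak_eigenvector e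
    (fun n => jacobiEigenvalue α β n + (c ^ 2 + 1)) (c ^ 2 + 1)
    (Filter.tendsto_atTop_add_const_right _ _ (tendsto_jacobiEigenvalue α β))
    (fun n => by linarith [jacobiEigenvalue_nonneg hα hβ n]) (c ^ 2 • M) (fun u v => ?_) ?_ _
    fun F ν hF => ?_
  · rw [_root_.smul_apply, _root_.smul_apply, inner_smul_left, inner_smul_right, real_inner_comm,
      hMi, hMi]
    simp only [mul_right_comm]
    rfl
  · rw [norm_smul, Real.norm_eq_abs, abs_of_nonneg (sq_nonneg c)]
    nlinarith [sq_nonneg c, norm_nonneg M]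
  · by_cases hF0 : F = 0
    · rw [hF0, inner_zero_left]
    have hFae : (F : ℝ → ℝ) =ᵐ[weightMeasure α β] F := Filter.EventuallyEq.refl _ _
    obtain ⟨ψ, hψ, hfψ, hop⟩ := exists_analytic_eigenfunction_of_weak hα hβ (c := c)
      (χ := ν - (c ^ 2 + 1)) (Lp.memLp F) fun n => by
        have := hF n
        rw [_root_.smul_apply, inner_smul_right, hMi, real_inner_eq_integral (he n) hFae] at this
        have e1 : ∫ x, x ^ 2 * e n x * F x ∂(weightMeasure α β)
            = ∫ x, x ^ 2 * jacobiFun α β n x * F x ∂(weightMeasure α β) := by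
          refine integral_congr_ae ?_
          filter_upwards [he n] with x hx
          rw [hx]
        rw [e1] at this
        linear_combination this
    rw [real_inner_eq_integral hfψ hgL]
    refine h (ν - (c ^ 2 + 1)) ψ ⟨(contDiff_of_analytic hψ).contDiffOn, ?_, hop⟩
    by_contra! hψ0
    refine hF0 ((Lp.eq_zero_iff_ae_eq_zero).2 ?_)
    filter_upwards [hfψ, ae_mem_I α β] with x h1 h2
    rw [h1, hψ0 x h2, Pi.zero_apply]

end Regularity

end PerturbedJacobi
namespace PerturbedJacobi

/-! ### Simplicity of the eigenvalues -/

section Uniqueness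

open Filter Topology

variable {c α β χ : ℝ}

/-- Indicial equation: at a point `x₀` of `I` the nonnegative integer exponents of the differential
equation are `0` and `1` in the interior, and only `0` at an endpoint, the other exponents there
being `-α` and `-β`. -/
lemma eq_zero_of_analytic_of_vanish (hα : -1 < α) (hβ : -1 < β) {ψ : ℝ → ℝ}
    (hψ : AnalyticOnNhd ℝ ψ univ) (hop : ∀ x ∈ I, -op c α β ψ x = χ * ψ x) {x₀ : ℝ} (hx₀ : x₀ ∈ I)
    (h0 : ψ x₀ = 0) (h1 : x₀ = 1 ∨ x₀ = -1 ∨ deriv ψ x₀ = 0) : ψ = 0 := by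
  by_contra hne
  have hnz : ¬∀ᶠ z in 𝓝 x₀, ψ z = 0 := fun h => hne <| funext fun x =>
    hψ.eqOn_zero_of_preconnected_of_eventuallyEq_zero isPreconnected_univ (mem_univ x₀) h
      (mem_univ x)
  obtain ⟨k, g, hg, hg0, hψg⟩ :=
    (hψ x₀ (mem_univ _)).exists_eventuallyEq_pow_smul_nonzero_iff.2 hnz
  obtain _ | j := k
  · have := hψg.self_of_nhds
    rw [h0] at this
    simp only [pow_zero, one_smul] at this
    exact hg0 this.symm
  set h : ℝ → ℝ := fun x => (j + 1) * g x + (x - x₀) * deriv g x with hh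
  have hg' : AnalyticAt ℝ (deriv g) x₀ := hg.deriv
  have hha : AnalyticAt ℝ h x₀ := by fun_prop
  have hh' : AnalyticAt ℝ (deriv h) x₀ := hha.deriv
  have hd1 : ∀ᶠ x in 𝓝 x₀, deriv ψ x = (x - x₀) ^ j * h x := by
    filter_upwards [hψg.eventually_nhds, hg.eventually_analyticAt] with x hx hgx
    rw [EventuallyEq.deriv_eq hx]
    have e1 : HasDerivAt (fun x => (x - x₀) ^ (j + 1)) (((j + 1 : ℕ) : ℝ) * (x - x₀) ^ j * 1) x :=
      ((hasDerivAt_id x).sub_const x₀).pow (j + 1)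
    refine ((e1.mul hgx.differentiableAt.hasDerivAt).congr_deriv ?_).deriv
    rw [hh]
    push_cast
    ring
  have hd2 : ∀ᶠ x in 𝓝 x₀, (x - x₀) * deriv (deriv ψ) x
      = (x - x₀) ^ j * (j * h x + (x - x₀) * deriv h x) := by
    filter_upwards [hd1.eventually_nhds, hha.eventually_analyticAt] with x hx hhx
    rw [EventuallyEq.deriv_eq hx]
    have e1 : HasDerivAt (fun x => (x - x₀) ^ j) ((j : ℝ) * (x - x₀) ^ (j - 1) * 1) x :=
      ((hasDerivAt_id x).sub_const x₀).pow j
    rw [(e1.fun_mul hhx.differentiableAt.hasDerivAt).deriv]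
    obtain _ | i := j
    · simp
    · simp only [Nat.add_sub_cancel]
      ring
  have hhx₀ : h x₀ = (j + 1) * g x₀ := by simp [hh]
  have hhne : h x₀ ≠ 0 := by
    rw [hhx₀]
    exact mul_ne_zero (by positivity) hg0
  have hacc : (𝓝[≠] x₀ ⊓ 𝓟 I).NeBot := (uniqueDiffOn_I x₀ hx₀).accPt
  have hle : 𝓝[≠] x₀ ⊓ 𝓟 I ≤ 𝓝 x₀ := inf_le_left.trans nhdsWithin_le_nhds
  have hS : ∀ᶠ x in 𝓝[≠] x₀ ⊓ 𝓟 I, x - x₀ ≠ 0 ∧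
      (1 - x ^ 2) * (j * h x + (x - x₀) * deriv h x)
        + (x - x₀) * ((β - α) - (α + β + 2) * x) * h x
        + (χ - c ^ 2 * x ^ 2) * (x - x₀) ^ 2 * g x = 0 := by
    have hI : ∀ᶠ x in 𝓝[≠] x₀ ⊓ 𝓟 I, x ∈ I := mem_inf_of_right (mem_principal_self I)
    have hne : ∀ᶠ x in 𝓝[≠] x₀ ⊓ 𝓟 I, x ∈ ({x₀}ᶜ : Set ℝ) := mem_inf_of_left self_mem_nhdsWithin
    filter_upwards [hI, hne, hle hψg, hle hd1, hle hd2] with x hxI hxne e0 e1 e2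
    have hx : x - x₀ ≠ 0 := sub_ne_zero.2 hxne
    refine ⟨hx, ?_⟩
    have hode := hop x hxI
    rw [op_eq_deriv (contDiff_of_analytic hψ) hxI] at hode
    rw [smul_eq_mul] at e0
    refine mul_left_cancel₀ (pow_ne_zero j hx) ?_
    rw [mul_zero]
    have : (x - x₀) * ((1 - x ^ 2) * deriv (deriv ψ) x
      + ((β - α) - (α + β + 2) * x) * deriv ψ x + (χ - c ^ 2 * x ^ 2) * ψ x) = 0 := by
      linear_combination (-(x - x₀)) * hode
    rw [e0, e1] at this
    linear_combination this - (1 - x ^ 2) * e2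
  have hc1 := hg.continuousAt
  have hc2 := hha.continuousAt
  have hc3 := hh'.continuousAt
  have hlim : ∀ S : ℝ → ℝ, ContinuousAt S x₀ → (∀ᶠ x in 𝓝[≠] x₀ ⊓ 𝓟 I, S x = 0) → S x₀ = 0 :=
    fun S hSc hSe => tendsto_nhds_unique (hSc.tendsto.mono_left hle)
      (tendsto_const_nhds.congr' (hSe.mono fun x hx => hx.symm))
  have h1' : x₀ = 1 ∨ x₀ = -1 ∨ (1 - x₀ ^ 2 ≠ 0 ∧ deriv ψ x₀ = 0) := by
    by_cases hx : 1 - x₀ ^ 2 = 0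
    · rcases mul_eq_zero.1 (show (x₀ - 1) * (x₀ + 1) = 0 by linear_combination -hx) with h4 | h4
      · exact Or.inl (by linarith)
      · exact Or.inr (Or.inl (by linarith))
    · tauto
  rcases h1' with rfl | rfl | ⟨hx, h1⟩
  · have := hlim (fun x => -(1 + x) * (j * h x + (x - 1) * deriv h x)
      + ((β - α) - (α + β + 2) * x) * h x + (χ - c ^ 2 * x ^ 2) * (x - 1) * g x) (by fun_prop) (by
        filter_upwards [hS] with x hx
        refine mul_left_cancel₀ hx.1 ?_
        linear_combination hx.2)
    have h2 : -2 * ((j : ℝ) + 1 + α) * h 1 = 0 := by linear_combination this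
    have : 0 < (j : ℝ) + 1 + α := by linarith [(j.cast_nonneg : (0 : ℝ) ≤ j)]
    exact mul_ne_zero (mul_ne_zero (by norm_num) this.ne') hhne h2
  · have := hlim (fun x => (1 - x) * (j * h x + (x - (-1)) * deriv h x)
      + ((β - α) - (α + β + 2) * x) * h x + (χ - c ^ 2 * x ^ 2) * (x - (-1)) * g x) (by fun_prop)
      (by
        filter_upwards [hS] with x hx
        refine mul_left_cancel₀ hx.1 ?_
        linear_combination hx.2)
    have h2 : 2 * ((j : ℝ) + 1 + β) * h (-1) = 0 := by linear_combination this
    have : 0 < (j : ℝ) + 1 + β := by linarith [(j.cast_nonneg : (0 : ℝ) ≤ j)]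
    exact mul_ne_zero (mul_ne_zero (by norm_num) this.ne') hhne h2
  · have := hlim _ (by fun_prop) (hS.mono fun x hx => hx.2)
    simp only [sub_self, zero_mul, add_zero, ne_eq, OfNat.ofNat_ne_zero, not_false_eq_true,
      zero_pow, mul_zero] at this
    have hd := hd1.self_of_nhds
    rw [h1, sub_self] at hd
    obtain _ | i := j
    · rw [pow_zero, one_mul] at hd
      exact hhne hd.symm
    rcases mul_eq_zero.1 ((mul_eq_zero.1 this).resolve_left hx) with h3 | h3
    · exact absurd h3 (by positivity)
    · exact hhne h3

lemma IsEigenpair.apply_one_ne_zero (hα : -1 < α) (hβ : -1 < β) {f : ℝ → ℝ}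
    (hf : IsEigenpair c α β χ f) : f 1 ≠ 0 := by
  obtain ⟨ψ, hψ, hfψ, hψe⟩ := hf.exists_analytic hα hβ
  have h1 : (1 : ℝ) ∈ I := ⟨by norm_num, le_rfl⟩
  rw [hfψ h1]
  intro h0
  obtain ⟨x, -, hx⟩ := hψe.ne_zero
  exact hx (congrFun (eq_zero_of_analytic_of_vanish hα hβ hψ hψe.eigen h1 h0 (Or.inl rfl)) x)

lemma IsEigenpair.apply_neg_one_ne_zero (hα : -1 < α) (hβ : -1 < β) {f : ℝ → ℝ}
    (hf : IsEigenpair c α β χ f) : f (-1) ≠ 0 :=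
  hf.comp_neg.apply_one_ne_zero hβ hα

/-- The zeros of an analytic eigenfunction in `I` are simple. -/
lemma IsEigenpair.deriv_ne_zero (hα : -1 < α) (hβ : -1 < β) {ψ : ℝ → ℝ}
    (hψ : AnalyticOnNhd ℝ ψ univ) (hψe : IsEigenpair c α β χ ψ) {x₀ : ℝ} (hx₀ : x₀ ∈ I)
    (h0 : ψ x₀ = 0) : deriv ψ x₀ ≠ 0 := by
  intro h1
  obtain ⟨x, -, hx⟩ := hψe.ne_zero
  exact hx (congrFun (eq_zero_of_analytic_of_vanish hα hβ hψ hψe.eigen hx₀ h0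
    (Or.inr (Or.inr h1))) x)

lemma op_linear {u v : ℝ → ℝ} (hu : ContDiff ℝ 2 u) (hv : ContDiff ℝ 2 v) (s t : ℝ) {x : ℝ}
    (hx : x ∈ I) :
    op c α β (fun x => s * u x + t * v x) x = s * op c α β u x + t * op c α β v x := by
  have hd : ∀ {w : ℝ → ℝ}, ContDiff ℝ 2 w → Differentiable ℝ w ∧ Differentiable ℝ (deriv w) := by
    intro w hw
    have : ContDiff ℝ (1 + 1) w := by simpa [one_add_one_eq_two] using hw
    exact ⟨hw.differentiable (by norm_num),
      (contDiff_succ_iff_deriv.1 this).2.2.differentiable (by norm_num)⟩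
  obtain ⟨hu1, hu2⟩ := hd hu
  obtain ⟨hv1, hv2⟩ := hd hv
  have h1 : deriv (fun x => s * u x + t * v x) = fun x => s * deriv u x + t * deriv v x := by
    ext y
    rw [deriv_fun_add ((hu1 y).const_mul s) ((hv1 y).const_mul t), deriv_const_mul_field,
      deriv_const_mul_field]
  have h2 : deriv (fun x => s * deriv u x + t * deriv v x) x
      = s * deriv (deriv u) x + t * deriv (deriv v) x := by
    rw [deriv_fun_add ((hu2 x).const_mul s) ((hv2 x).const_mul t), deriv_const_mul_field,
      deriv_const_mul_field]
  rw [op_eq_deriv (by fun_prop) hx, op_eq_deriv hu hx, op_eq_deriv hv hx, h1, h2]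
  ring

/-- The eigenspaces are one-dimensional. -/
lemma IsEigenpair.exists_eq_mul (hα : -1 < α) (hβ : -1 < β) {f g : ℝ → ℝ}
    (hf : IsEigenpair c α β χ f) (hg : IsEigenpair c α β χ g) :
    ∃ t : ℝ, t ≠ 0 ∧ ∀ x ∈ I, f x = t * g x := by
  obtain ⟨φ, hφ, hfφ, hφe⟩ := hf.exists_analytic hα hβ
  obtain ⟨ψ, hψ, hgψ, hψe⟩ := hg.exists_analytic hα hβ
  have hφ1 := hφe.apply_one_ne_zero hα hβ
  have hψ1 := hψe.apply_one_ne_zero hα hβ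
  have hz := eq_zero_of_analytic_of_vanish (c := c) (χ := χ) hα hβ
    (ψ := fun x => ψ 1 * φ x + -φ 1 * ψ x) (fun x _ =>
      (analyticAt_const.mul (hφ x (mem_univ x))).add (analyticAt_const.mul (hψ x (mem_univ x))))
    (fun x hx => by
      rw [op_linear (contDiff_of_analytic hφ) (contDiff_of_analytic hψ) _ _ hx]
      have h1 := hφe.eigen x hx
      have h2 := hψe.eigen x hx
      linear_combination ψ 1 * h1 - φ 1 * h2)
    (show (1 : ℝ) ∈ I from ⟨by norm_num, le_rfl⟩) (by ring) (Or.inl rfl)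
  refine ⟨φ 1 / ψ 1, div_ne_zero hφ1 hψ1, fun x hx => ?_⟩
  have := congrFun hz x
  simp only [Pi.zero_apply] at this
  rw [hfφ hx, hgψ hx, div_mul_eq_mul_div, eq_div_iff hψ1]
  linear_combination this

lemma IsEigenpair.integral_mul_eq_zero (hα : -1 < α) (hβ : -1 < β) {χ' : ℝ} {f g : ℝ → ℝ}
    (hf : IsEigenpair c α β χ f) (hg : IsEigenpair c α β χ' g) (hne : χ ≠ χ') :
    ∫ x, f x * g x ∂(weightMeasure α β) = 0 := by
  have h := integral_op_mul (c := c) hα hβ hf.contDiffOn hg.contDiffOn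
  have h1 : ∫ x, op c α β f x * g x ∂(weightMeasure α β)
      = -χ * ∫ x, f x * g x ∂(weightMeasure α β) := by
    rw [← integral_const_mul]
    refine integral_congr_ae ?_
    filter_upwards [ae_mem_I α β] with x hx
    linear_combination -g x * hf.eigen x hx
  have h2 : ∫ x, f x * op c α β g x ∂(weightMeasure α β)
      = -χ' * ∫ x, f x * g x ∂(weightMeasure α β) := by
    rw [← integral_const_mul]
    refine integral_congr_ae ?_
    filter_upwards [ae_mem_I α β] with x hx
    linear_combination -f x * hg.eigen x hx
  rw [h1, h2] at h
  have : (χ' - χ) * ∫ x, f x * g x ∂(weightMeasure α β) = 0 := by linear_combination h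
  exact (mul_eq_zero.1 this).resolve_left (sub_ne_zero.2 hne.symm)

lemma integral_mul_weight (f : ℝ → ℝ) :
    ∫ x in (-1 : ℝ)..1, f x ^ 2 * weight α β x = ∫ x, f x * f x ∂(weightMeasure α β) := by
  rw [integral_weightMeasure]
  simp only [smul_eq_mul, pow_two, mul_comm]

lemma IsEigenpair.integral_mul_self_pos (hα : -1 < α) (hβ : -1 < β) {f : ℝ → ℝ}
    (hf : IsEigenpair c α β χ f) : 0 < ∫ x, f x * f x ∂(weightMeasure α β) := by
  have hc : ContinuousOn (fun x => f x * f x) I := hf.contDiffOn.continuousOn.mul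
    hf.contDiffOn.continuousOn
  have h0 : 0 ≤ᵐ[weightMeasure α β] fun x => f x * f x :=
    Filter.Eventually.of_forall fun x => mul_self_nonneg _
  refine (integral_nonneg_of_ae h0).lt_of_ne fun h => ?_
  rw [eq_comm, integral_eq_zero_iff_of_nonneg_ae h0 (integrable_of_continuousOn hα hβ hc)] at h
  obtain ⟨x, hx, hne⟩ := hf.ne_zero
  exact hne (mul_self_eq_zero.1 (eqOn_of_ae_eq hc continuousOn_const h hx))

lemma IsEigenpair.const_mul {ψ : ℝ → ℝ} (hψ : AnalyticOnNhd ℝ ψ univ)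
    (hψe : IsEigenpair c α β χ ψ) {t : ℝ} (ht : t ≠ 0) :
    IsEigenpair c α β χ fun x => t * ψ x where
  contDiffOn := contDiffOn_const.mul hψe.contDiffOn
  ne_zero := by
    obtain ⟨x, hx, hne⟩ := hψe.ne_zero
    exact ⟨x, hx, mul_ne_zero ht hne⟩
  eigen x hx := by
    have h := op_linear (c := c) (α := α) (β := β) (contDiff_of_analytic hψ)
      (contDiff_of_analytic hψ) t 0 hx
    simp only [zero_mul, add_zero] at h
    rw [h, mul_left_comm, ← hψe.eigen x hx]
    ring

/-- Every eigenvalue has a normalized analytic eigenfunction that is positive at `1`. -/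
lemma IsEigenvalue.exists_normalized (hα : -1 < α) (hβ : -1 < β) (h : IsEigenvalue c α β χ) :
    ∃ ψ : ℝ → ℝ, AnalyticOnNhd ℝ ψ univ ∧ IsEigenpair c α β χ ψ ∧ 0 < ψ 1 ∧
      ∫ x, ψ x * ψ x ∂(weightMeasure α β) = 1 := by
  obtain ⟨f, hf⟩ := h
  obtain ⟨ψ, hψ, -, hψe⟩ := hf.exists_analytic hα hβ
  have hpos := hψe.integral_mul_self_pos hα hβ
  set A := ∫ x, ψ x * ψ x ∂(weightMeasure α β) with hA
  have hs := Real.sqrt_pos.2 hpos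
  have h1 := hψe.apply_one_ne_zero hα hβ
  have key : ∃ t : ℝ, t ^ 2 = A⁻¹ ∧ 0 < t * ψ 1 := by
    rcases lt_or_gt_of_ne h1 with h | h
    · exact ⟨-(√A)⁻¹, by rw [neg_sq, inv_pow, Real.sq_sqrt hpos.le],
        mul_pos_of_neg_of_neg (neg_neg_of_pos (inv_pos.2 hs)) h⟩
    · exact ⟨(√A)⁻¹, by rw [inv_pow, Real.sq_sqrt hpos.le], mul_pos (inv_pos.2 hs) h⟩
  obtain ⟨t, ht2, ht1⟩ := key
  refine ⟨fun x => t * ψ x, fun x _ => analyticAt_const.mul (hψ x (mem_univ x)),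
    hψe.const_mul hψ (fun h0 => by simp [h0] at ht1), ht1, ?_⟩
  simp only [mul_mul_mul_comm t]
  rw [integral_const_mul, ← pow_two, ht2, ← hA, inv_mul_cancel₀ hpos.ne']

/-- A normalized eigenfunction is unique up to its sign. -/
lemma IsEigenpair.eqOn_or_eqOn_neg (hα : -1 < α) (hβ : -1 < β) {f g : ℝ → ℝ}
    (hf : IsEigenpair c α β χ f) (hg : IsEigenpair c α β χ g)
    (hf1 : ∫ x, f x * f x ∂(weightMeasure α β) = 1)
    (hg1 : ∫ x, g x * g x ∂(weightMeasure α β) = 1) : EqOn f g I ∨ EqOn f (-g) I := by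
  obtain ⟨t, -, ht⟩ := hf.exists_eq_mul hα hβ hg
  have h : ∫ x, f x * f x ∂(weightMeasure α β) = t ^ 2 * ∫ x, g x * g x ∂(weightMeasure α β) := by
    rw [← integral_const_mul]
    refine integral_congr_ae ?_
    filter_upwards [ae_mem_I α β] with x hx
    rw [ht x hx]
    ring
  rw [hf1, hg1, mul_one, eq_comm] at h
  rcases sq_eq_one_iff.1 h with rfl | rfl
  · exact Or.inl fun x hx => by rw [ht x hx, one_mul]
  · exact Or.inr fun x hx => by rw [ht x hx, Pi.neg_apply, neg_one_mul]

end Uniqueness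

end PerturbedJacobi
namespace PerturbedJacobi

/-! ### Counting eigenvalues -/

section Counting

/-- Min-max principle: if the quadratic form of an operator is at most `X` on an `N`-dimensional
space and that of a perturbation by at most `κ` is at least `Y > X + κ` on the orthogonal complement
of an `m`-dimensional space, then `N ≤ m`. The first form is given by orthonormal eigenvectors `U`,
the second one by an eigenbasis `V`, and `B` is the difference of the operators. -/
lemma card_le_of_forall_eigenvalue_le {H : Type*} [NormedAddCommGroup H] [InnerProductSpace ℝ H]
    {N m : ℕ} (U : Fin N → H) (hU : Orthonormal ℝ U) (V : HilbertBasis ℕ ℝ H) (B : H →L[ℝ] H)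
    (ξ : Fin N → ℝ) (η : ℕ → ℝ) {X Y κ : ℝ} (hB : ∀ g, inner ℝ (B g) g ≤ κ * ‖g‖ ^ 2)
    (h : ∀ i j, inner ℝ (ξ i • U i + B (U i)) (V j) = η j * inner ℝ (U i) (V j))
    (hξ : ∀ i, ξ i ≤ X) (hη : ∀ j, m ≤ j → Y ≤ η j) (hXY : X + κ < Y) : N ≤ m := by
  by_contra! hlt
  let L : (Fin N → ℝ) →ₗ[ℝ] (Fin m → ℝ) :=
    { toFun := fun t j => inner ℝ (∑ i, t i • U i) (V j)
      map_add' := fun s t => by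
        ext j
        simp [add_smul, Finset.sum_add_distrib, inner_add_left]
      map_smul' := fun r t => by
        ext j
        simp [mul_smul, ← Finset.smul_sum, inner_smul_left] }
  have hker : LinearMap.ker L ≠ ⊥ := LinearMap.ker_ne_bot_of_finrank_lt (by simpa using hlt)
  obtain ⟨t, ht, ht0⟩ := (Submodule.ne_bot_iff _).1 hker
  set g := ∑ i, t i • U i with hg
  have hgV : ∀ j < m, inner ℝ g (V j) = 0 := fun j hj => congrFun (LinearMap.mem_ker.1 ht) ⟨j, hj⟩
  have hgn : ‖g‖ ^ 2 = ∑ i, t i * t i := by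
    rw [← real_inner_self_eq_norm_sq, hg, hU.inner_sum]
    simp
  have hgpos : 0 < ‖g‖ ^ 2 := by
    rw [hgn]
    obtain ⟨i, hi⟩ := Function.ne_iff.1 ht0
    exact Finset.sum_pos' (fun i _ => mul_self_nonneg _)
      ⟨i, Finset.mem_univ i, mul_self_pos.2 hi⟩
  set w := ∑ i, t i • (ξ i • U i + B (U i)) with hw
  have hwg : inner ℝ w g ≤ (X + κ) * ‖g‖ ^ 2 := by
    have e1 : w = (∑ i, (t i * ξ i) • U i) + B g := by
      rw [hw, hg, map_sum, ← Finset.sum_add_distrib]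
      simp [smul_smul]
    rw [e1, inner_add_left, add_mul]
    refine add_le_add ?_ (hB g)
    rw [hgn, hg, hU.inner_sum, Finset.mul_sum]
    refine Finset.sum_le_sum fun i _ => ?_
    simp only [conj_trivial]
    nlinarith [mul_le_mul_of_nonneg_right (hξ i) (mul_self_nonneg (t i))]
  have hwV : ∀ j, inner ℝ w (V j) = η j * inner ℝ g (V j) := fun j => by
    rw [hw, hg, sum_inner, sum_inner, Finset.mul_sum]
    refine Finset.sum_congr rfl fun i _ => ?_
    rw [inner_smul_left, inner_smul_left, h]
    ring
  have hlow : Y * ‖g‖ ^ 2 ≤ inner ℝ w g := by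
    rw [← real_inner_self_eq_norm_sq]
    refine hasSum_le (fun j => ?_) ((V.hasSum_inner_mul_inner g g).mul_left Y)
      (V.hasSum_inner_mul_inner w g)
    rw [hwV, real_inner_comm g (V j)]
    rcases lt_or_ge j m with hj | hj
    · simp [hgV j hj]
    · nlinarith [mul_le_mul_of_nonneg_right (hη j hj) (mul_self_nonneg (inner ℝ g (V j)))]
  nlinarith

/-- If an infinite set of reals has finitely many elements below each bound, then it has an element
with exactly `n` elements below it. -/
lemma exists_encard_lt_eq {E : Set ℝ} (hE : E.Infinite) (hfin : ∀ X, {x | x < X ∧ x ∈ E}.Finite)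
    (n : ℕ) : ∃ x ∈ E, {y | y < x ∧ y ∈ E}.encard = n := by
  have hmin : ∀ S ⊆ E, S.Nonempty → ∃ x ∈ S, ∀ y ∈ S, x ≤ y := by
    intro S hS ⟨z, hz⟩
    obtain ⟨x, hx, hxm⟩ := ((hfin (z + 1)).subset (t := {x | x < z + 1 ∧ x ∈ S})
      fun x hx => ⟨hx.1, hS hx.2⟩).exists_minimal ⟨z, by simpa using hz⟩
    refine ⟨x, hx.2, fun y hy => ?_⟩
    by_contra! hlt
    exact absurd (hxm ⟨hlt.trans hx.1, hy⟩ hlt.le) (not_le.2 hlt)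
  induction n with
  | zero =>
    obtain ⟨x, hx, hxm⟩ := hmin E subset_rfl hE.nonempty
    refine ⟨x, hx, ?_⟩
    rw [Nat.cast_zero, encard_eq_zero, eq_empty_iff_forall_notMem]
    exact fun y hy => absurd (hxm y hy.2) (not_le.2 hy.1)
  | succ n ih =>
    obtain ⟨x, hx, hxn⟩ := ih
    have hne : {y | x < y ∧ y ∈ E}.Nonempty := by
      by_contra hemp
      refine hE ((hfin (x + 1)).subset fun y hy => ⟨?_, hy⟩)
      by_contra! hlt
      exact hemp ⟨y, by linarith, hy⟩
    obtain ⟨z, hz, hzm⟩ := hmin _ (fun y hy => hy.2) hne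
    refine ⟨z, hz.2, ?_⟩
    have : {y | y < z ∧ y ∈ E} = insert x {y | y < x ∧ y ∈ E} := by
      ext y
      simp only [mem_ofPred_eq, mem_insert_iff]
      constructor
      · rintro ⟨h1, h2⟩
        rcases lt_trichotomy y x with h | h | h
        · exact Or.inr ⟨h, h2⟩
        · exact Or.inl h
        · exact absurd (hzm y ⟨h, h2⟩) (not_le.2 h1)
      · rintro (rfl | h)
        · exact ⟨hz.1, hx⟩
        · exact ⟨h.1.trans hz.1, h.2⟩
    rw [this, encard_insert_of_notMem (by simp), hxn]
    norm_cast

lemma encard_lt_strictMono {E : Set ℝ} {x y : ℝ} (hx : x ∈ E) (hxy : x < y) {m n : ℕ}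
    (hm : {z | z < x ∧ z ∈ E}.encard = m) (hn : {z | z < y ∧ z ∈ E}.encard = n) : m < n := by
  have h : insert x {z | z < x ∧ z ∈ E} ⊆ {z | z < y ∧ z ∈ E} := by
    rintro z (rfl | hz)
    · exact ⟨hxy, hx⟩
    · exact ⟨hz.1.trans hxy, hz.2⟩
  have := encard_le_encard h
  rw [encard_insert_of_notMem (by simp), hm, hn] at this
  exact_mod_cast this

variable {c α β : ℝ}

lemma real_inner_sq_mul_le {M : Lp ℝ 2 (weightMeasure α β) →L[ℝ] Lp ℝ 2 (weightMeasure α β)}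
    (hM1 : ‖M‖ ≤ 1) (hM : ∀ f, (M f : ℝ → ℝ) =ᵐ[weightMeasure α β] fun x => x ^ 2 * f x)
    (g : Lp ℝ 2 (weightMeasure α β)) : 0 ≤ inner ℝ (M g) g ∧ inner ℝ (M g) g ≤ ‖g‖ ^ 2 := by
  constructor
  · rw [real_inner_eq_integral (hM g) (Filter.EventuallyEq.refl _ _)]
    refine integral_nonneg fun x => ?_
    simp only [Pi.zero_apply, mul_assoc]
    exact mul_nonneg (sq_nonneg x) (mul_self_nonneg _)
  · refine (real_inner_le_norm _ _).trans ?_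
    rw [pow_two]
    gcongr
    simpa using M.le_of_opNorm_le hM1 g

/-- Comparison of the eigenvalues of two of the operators, for different values of `c`. -/
lemma card_le_of_eigenpairs (hα : -1 < α) (hβ : -1 < β) {c₁ c₂ : ℝ} {N m : ℕ}
    (u : Fin N → ℝ → ℝ) (ξ : Fin N → ℝ) (hu : ∀ i, IsEigenpair c₁ α β (ξ i) (u i))
    (huo : ∀ i j, ∫ x, u i x * u j x ∂(weightMeasure α β) = if i = j then 1 else 0)
    (V : HilbertBasis ℕ ℝ (Lp ℝ 2 (weightMeasure α β))) (v : ℕ → ℝ → ℝ) (η : ℕ → ℝ)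
    (hv : ∀ j, IsEigenpair c₂ α β (η j) (v j))
    (hV : ∀ j, (V j : ℝ → ℝ) =ᵐ[weightMeasure α β] v j) {X Y κ : ℝ}
    (hκ : 0 ≤ κ) (hκ' : c₂ ^ 2 - c₁ ^ 2 ≤ κ) (hξ : ∀ i, ξ i ≤ X) (hη : ∀ j, m ≤ j → Y ≤ η j)
    (hXY : X + κ < Y) : N ≤ m := by
  obtain ⟨M, hM1, hM⟩ := exists_sq_mul_operator α β
  have hm : ∀ i, MemLp (u i) 2 (weightMeasure α β) := fun i =>
    memLp_of_continuousOn hα hβ (hu i).contDiffOn.continuousOn 2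
  have hUu : ∀ i, ((hm i).toLp _ : ℝ → ℝ) =ᵐ[weightMeasure α β] u i := fun i => (hm i).coeFn_toLp
  refine card_le_of_forall_eigenvalue_le (fun i => (hm i).toLp _) ?_ V ((c₂ ^ 2 - c₁ ^ 2) • M) ξ η
    (κ := κ) (fun g => ?_) (fun i j => ?_) hξ hη hXY
  · refine orthonormal_iff_ite.2 fun i j => ?_
    rw [real_inner_eq_integral (hUu i) (hUu j), huo]
  · obtain ⟨h0, h1⟩ := real_inner_sq_mul_le hM1 hM g
    rw [_root_.smul_apply, inner_smul_left]
    simp only [conj_trivial]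
    nlinarith [mul_le_mul_of_nonneg_right hκ' h0, mul_le_mul_of_nonneg_left h1 hκ]
  · have hl : ((ξ i • (hm i).toLp _ + ((c₂ ^ 2 - c₁ ^ 2) • M) ((hm i).toLp _) :
        Lp ℝ 2 (weightMeasure α β)) : ℝ → ℝ) =ᵐ[weightMeasure α β]
        fun x => -op c₂ α β (u i) x := by
      filter_upwards [Lp.coeFn_add (ξ i • (hm i).toLp _) (((c₂ ^ 2 - c₁ ^ 2) • M) ((hm i).toLp _)),
        Lp.coeFn_smul (ξ i) ((hm i).toLp _), Lp.coeFn_smul (c₂ ^ 2 - c₁ ^ 2) (M ((hm i).toLp _)),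
        hM ((hm i).toLp _), hUu i, ae_mem_I α β] with x h1 h2 h3 h4 h5 hx
      rw [h1, Pi.add_apply, h2, _root_.smul_apply, h3, Pi.smul_apply, Pi.smul_apply, h4, h5,
        op_eq_op_add c₂ c₁, smul_eq_mul, smul_eq_mul]
      linear_combination -(hu i).eigen x hx
    rw [real_inner_eq_integral hl (hV j), real_inner_eq_integral (hUu i) (hV j)]
    simp only [neg_mul]
    rw [integral_neg, integral_op_mul hα hβ (hu i).contDiffOn (hv j).contDiffOn, ← integral_neg,
      ← integral_const_mul]
    refine integral_congr_ae ?_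
    filter_upwards [ae_mem_I α β] with x hx
    linear_combination u i x * (hv j).eigen x hx

lemma isEigenpair_jacobiFun (hα : -1 < α) (hβ : -1 < β) (n : ℕ) :
    IsEigenpair 0 α β (jacobiEigenvalue α β n) (jacobiFun α β n) where
  contDiffOn := (contDiff_jacobiFun n).contDiffOn
  ne_zero := by
    obtain ⟨x, hx, hne⟩ := (isEigenpair_jacobiPoly hα hβ n).ne_zero
    refine ⟨x, hx, fun h => hne ?_⟩
    rw [jacobiPoly_eq_smul_jacobiFun hα hβ, h, mul_zero]
  eigen x hx := by rw [op_jacobiFun hα 0 n hx]; ring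

lemma finite_setOf_eigenvalue_lt (hα : -1 < α) (hβ : -1 < β) (X : ℝ) :
    {χ | χ < X ∧ IsEigenvalue c α β χ}.Finite := by
  obtain ⟨e, he⟩ := exists_jacobi_hilbertBasis hα hβ
  obtain ⟨m, hm⟩ := Filter.eventually_atTop.1
    ((tendsto_jacobiEigenvalue α β).eventually_ge_atTop (X + 1))
  by_contra hinf
  obtain ⟨s, hs, hcard⟩ := (show {χ | χ < X ∧ IsEigenvalue c α β χ}.Infinite from
    hinf).exists_subset_card_eq (m + 1)
  choose! ψ hψ using fun χ (hχ : χ ∈ s) => (hs hχ).2.exists_normalized hα hβ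
  have hle := card_le_of_eigenpairs (c₁ := c) (c₂ := 0) hα hβ (N := s.card) (m := m)
    (fun i => ψ (s.equivFin.symm i)) (fun i => s.equivFin.symm i)
    (fun i => (hψ _ (s.equivFin.symm i).2).2.1) (fun i j => ?_) e _ _
    (isEigenpair_jacobiFun hα hβ) he (X := X) (Y := X + 1) (κ := 0) le_rfl
    (by nlinarith [sq_nonneg c]) (fun i => (hs (s.equivFin.symm i).2).1.le)
    (fun j hj => hm j hj) (by linarith)
  · omega
  · split_ifs with h
    · rw [h]
      exact (hψ _ (s.equivFin.symm j).2).2.2.2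
    · refine (hψ _ (s.equivFin.symm i).2).2.1.integral_mul_eq_zero hα hβ
        (hψ _ (s.equivFin.symm j).2).2.1 fun h' => h ?_
      exact s.equivFin.symm.injective (Subtype.ext h')

lemma infinite_setOf_eigenvalue (hα : -1 < α) (hβ : -1 < β) :
    {χ | IsEigenvalue c α β χ}.Infinite := by
  intro hfin
  obtain ⟨e, he⟩ := exists_jacobi_hilbertBasis hα hβ
  choose! ψ hψ using fun χ (hχ : IsEigenvalue c α β χ) => hχ.exists_normalized hα hβ
  have : Fintype {χ | IsEigenvalue c α β χ} := hfin.fintype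
  have hm : ∀ χ : {χ | IsEigenvalue c α β χ}, MemLp (ψ χ) 2 (weightMeasure α β) := fun χ =>
    memLp_of_continuousOn hα hβ (hψ χ χ.2).2.1.contDiffOn.continuousOn 2
  set S := Submodule.span ℝ (range fun χ => (hm χ).toLp _) with hS
  have hfd : FiniteDimensional ℝ S := FiniteDimensional.span_of_finite ℝ (finite_range _)
  have hbot : Sᗮ = ⊥ := by
    rw [eq_bot_iff]
    intro g hg
    rw [Submodule.mem_bot, Lp.eq_zero_iff_ae_eq_zero]
    refine ae_eq_zero_of_forall_integral_eigenfunction hα hβ c (Lp.memLp g) fun χ φ hφ => ?_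
    have hχ : IsEigenvalue c α β χ := ⟨φ, hφ⟩
    have h0 := (Submodule.mem_orthogonal _ _).1 hg _
      (Submodule.subset_span ⟨(⟨χ, hχ⟩ : {χ | IsEigenvalue c α β χ}), rfl⟩)
    rw [real_inner_eq_integral (hm ⟨χ, hχ⟩).coeFn_toLp (Filter.EventuallyEq.refl _ _)] at h0
    obtain ⟨t, -, ht⟩ := hφ.exists_eq_mul hα hβ (hψ χ hχ).2.1
    calc _ = ∫ x, t * (ψ χ x * g x) ∂(weightMeasure α β) := by
          refine integral_congr_ae ?_
          filter_upwards [ae_mem_I α β] with x hx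
          rw [ht x hx, mul_assoc]
      _ = 0 := by rw [integral_const_mul, h0, mul_zero]
  have htop : S = ⊤ := Submodule.orthogonal_eq_bot_iff.1 hbot
  have hfd' : FiniteDimensional ℝ (Lp ℝ 2 (weightMeasure α β)) := by
    rw [htop] at hfd
    exact Module.Finite.of_surjective (⊤ : Submodule ℝ (Lp ℝ 2 (weightMeasure α β))).subtype
      fun x => ⟨⟨x, trivial⟩, rfl⟩
  exact not_finite_iff_infinite.2 inferInstance (e.orthonormal.linearIndependent.finite)

lemma exists_nth_eigenvalue (c : ℝ) (hα : -1 < α) (hβ : -1 < β) (n : ℕ) :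
    ∃ χ, IsEigenvalue c α β χ ∧ {χ' | χ' < χ ∧ IsEigenvalue c α β χ'}.encard = n :=
  exists_encard_lt_eq (infinite_setOf_eigenvalue hα hβ) (finite_setOf_eigenvalue_lt hα hβ) n

lemma IsNthEigenfunction.eigenvalue_lt {m n : ℕ} {χ χ' : ℝ} {f g : ℝ → ℝ}
    (hf : IsNthEigenfunction c α β m χ f) (hg : IsNthEigenfunction c α β n χ' g) (hmn : m < n) :
    χ < χ' := by
  by_contra! h
  rcases h.lt_or_eq with h | rfl
  · have := encard_lt_strictMono (E := {χ | IsEigenvalue c α β χ}) ⟨g, hg.eigenpair⟩ h hg.index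
      hf.index
    omega
  · have := hf.index.symm.trans hg.index
    norm_cast at this
    omega

lemma IsNthEigenfunction.eigenvalue_eq {n : ℕ} {χ χ' : ℝ} {f g : ℝ → ℝ}
    (hf : IsNthEigenfunction c α β n χ f) (hg : IsNthEigenfunction c α β n χ' g) : χ = χ' := by
  rcases lt_trichotomy χ χ' with h | h | h
  · exact absurd (encard_lt_strictMono (E := {χ | IsEigenvalue c α β χ}) ⟨f, hf.eigenpair⟩ h
      hf.index hg.index) (lt_irrefl n)
  · exact h
  · exact absurd (encard_lt_strictMono (E := {χ | IsEigenvalue c α β χ}) ⟨g, hg.eigenpair⟩ h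
      hg.index hf.index) (lt_irrefl n)

lemma IsNthEigenfunction.integral_mul_self {n : ℕ} {χ : ℝ} {f : ℝ → ℝ}
    (hf : IsNthEigenfunction c α β n χ f) : ∫ x, f x * f x ∂(weightMeasure α β) = 1 := by
  rw [← integral_mul_weight, hf.normalized]

/-- Existence of the `n`-th eigenfunction, with its analytic extension. -/
lemma exists_isNthEigenfunction (c : ℝ) (hα : -1 < α) (hβ : -1 < β) (n : ℕ) :
    ∃ (χ : ℝ) (ψ : ℝ → ℝ), IsNthEigenfunction c α β n χ ψ ∧ 0 < ψ 1 ∧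
      AnalyticOnNhd ℝ ψ univ := by
  obtain ⟨χ, hχ, hn⟩ := exists_nth_eigenvalue c hα hβ n
  obtain ⟨ψ, hψ, hψe, h1, hint⟩ := hχ.exists_normalized hα hβ
  exact ⟨χ, ψ, ⟨hψe, hn, by rw [integral_mul_weight, hint]⟩, h1, hψ⟩

lemma orthonormal_of_isNthEigenfunction (hα : -1 < α) (hβ : -1 < β) {χ : ℕ → ℝ} {ψ : ℕ → ℝ → ℝ}
    (h : ∀ n, IsNthEigenfunction c α β n (χ n) (ψ n)) (m n : ℕ) :
    ∫ x, ψ m x * ψ n x ∂(weightMeasure α β) = if m = n then 1 else 0 := by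
  split_ifs with hmn
  · rw [hmn]
    exact (h n).integral_mul_self
  · refine (h m).eigenpair.integral_mul_eq_zero hα hβ (h n).eigenpair ?_
    rcases lt_or_gt_of_ne hmn with h1 | h1
    · exact ((h m).eigenvalue_lt (h n) h1).ne
    · exact ((h n).eigenvalue_lt (h m) h1).ne'

/-- The normalized eigenfunctions form an orthonormal basis, for any choice of signs. -/
theorem exists_hilbertBasis_eigenfunction (𝕜 : Type*) [RCLike 𝕜] (hα : -1 < α) (hβ : -1 < β)
    {χ : ℕ → ℝ} {ψ : ℕ → ℝ → ℝ} (h : ∀ n, IsNthEigenfunction c α β n (χ n) (ψ n)) :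
    ∃ b : HilbertBasis ℕ 𝕜 (Lp 𝕜 2 (weightMeasure α β)),
      ∀ n, (b n : ℝ → 𝕜) =ᵐ[weightMeasure α β] fun x => (ψ n x : 𝕜) := by
  refine exists_hilbertBasis 𝕜 hα hβ ψ (fun n => (h n).eigenpair.contDiffOn.continuousOn)
    (orthonormal_of_isNthEigenfunction hα hβ h) fun g hg h0 => ?_
  refine ae_eq_zero_of_forall_integral_eigenfunction hα hβ c hg fun ξ φ hφ => ?_
  -- an arbitrary eigenvalue is the `n`-th one, where `n` is the number of eigenvalues below it
  have hfin : {χ' | χ' < ξ ∧ IsEigenvalue c α β χ'}.Finite := finite_setOf_eigenvalue_lt hα hβ ξ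
  obtain ⟨ψ', -, hψe, -, hint⟩ := IsEigenvalue.exists_normalized hα hβ ⟨φ, hφ⟩
  have hN : IsNthEigenfunction c α β hfin.toFinset.card ξ ψ' :=
    ⟨hψe, hfin.encard_eq_coe_toFinset_card, by rw [integral_mul_weight, hint]⟩
  have heq := hN.eigenvalue_eq (h _)
  generalize hfin.toFinset.card = n at heq
  subst heq
  obtain ⟨t, -, ht⟩ := hφ.exists_eq_mul hα hβ (h n).eigenpair
  calc _ = ∫ x, t * (ψ n x * g x) ∂(weightMeasure α β) := by
        refine integral_congr_ae ?_
        filter_upwards [ae_mem_I α β] with x hx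
        rw [ht x hx, mul_assoc]
    _ = 0 := by rw [integral_const_mul, h0, mul_zero]

/-- The perturbation raises the eigenvalues by at most `c²`. -/
lemma IsNthEigenfunction.eigenvalue_le (hα : -1 < α) (hβ : -1 < β) {n : ℕ} {χ : ℝ} {f : ℝ → ℝ}
    (hf : IsNthEigenfunction c α β n χ f) : χ ≤ jacobiEigenvalue α β n + c ^ 2 := by
  choose χs ψ hψ using fun n => exists_isNthEigenfunction c hα hβ n
  have hN : ∀ n, IsNthEigenfunction c α β n (χs n) (ψ n) := fun n => (hψ n).1
  obtain ⟨V, hV⟩ := exists_hilbertBasis_eigenfunction ℝ hα hβ hN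
  rw [hf.eigenvalue_eq (hN n)]
  by_contra! hlt
  have := card_le_of_eigenpairs (c₁ := 0) (c₂ := c) hα hβ (N := n + 1) (m := n)
    (fun i => jacobiFun α β i) (fun i => jacobiEigenvalue α β i)
    (fun i => isEigenpair_jacobiFun hα hβ i)
    (fun i j => by simp only [jacobiFun_orthonormal hα hβ, Fin.ext_iff]) V ψ χs
    (fun j => (hN j).eigenpair) hV (X := jacobiEigenvalue α β n) (κ := c ^ 2) (sq_nonneg c)
    (by simp) (fun i => (jacobiEigenvalue_strictMono hα hβ).monotone (by omega))
    (fun j hj => ?_) hlt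
  · omega
  · rcases hj.lt_or_eq with hj | rfl
    · exact ((hN n).eigenvalue_lt (hN j) hj).le
    · exact le_rfl

end Counting

end PerturbedJacobi
namespace PerturbedJacobi

/-! ### Zeros of the eigenfunctions -/

section Oscillation

open Filter Topology

variable {c α β : ℝ}

/-- If every gap of `S ∪ {lo, hi}` contains a point of `T`, then `T` has more points than `S`. -/
lemma card_lt_card_of_interlacing {S T : Finset ℝ} {lo hi : ℝ} (hlh : lo < hi)
    (hS : ∀ s ∈ S, lo < s ∧ s < hi)
    (h : ∀ a ∈ insert lo S, ∀ b ∈ insert hi S, a < b → (∀ x ∈ S, ¬(a < x ∧ x < b)) →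
      ∃ t ∈ T, a < t ∧ t < b) : S.card < T.card := by
  have key : ∀ a ∈ insert lo S, ∃ t ∈ T, a < t ∧ ∀ s ∈ S, a < s → t < s := by
    intro a ha
    have hahi : a < hi := by
      rcases Finset.mem_insert.1 ha with rfl | ha
      · exact hlh
      · exact (hS a ha).2
    obtain ⟨b, hb, hbm⟩ := ((insert hi S).filter (a < ·)).exists_min_image id
      ⟨hi, by simp [hahi]⟩
    rw [Finset.mem_filter] at hb
    have hmin : ∀ s ∈ S, a < s → b ≤ s := fun s hs has =>
      hbm s (Finset.mem_filter.2 ⟨Finset.mem_insert_of_mem hs, has⟩)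
    obtain ⟨t, ht, hat, htb⟩ := h a ha b hb.1 hb.2 fun x hx hab =>
      absurd (hmin x hx hab.1) (not_le.2 hab.2)
    exact ⟨t, ht, hat, fun s hs has => htb.trans_le (hmin s hs has)⟩
  choose! φ hφT hφ1 hφ2 using key
  have hlo : lo ∉ S := fun h => lt_irrefl _ (hS lo h).1
  rw [← Nat.succ_le_iff, Nat.succ_eq_add_one, ← Finset.card_insert_of_notMem hlo]
  refine Finset.card_le_card_of_injOn φ (fun a ha => hφT a ha) ?_
  have hlt : ∀ a ∈ insert lo S, ∀ b ∈ insert lo S, a < b → φ a < φ b := by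
    intro a ha b hb hab
    have hbS : b ∈ S := by
      rcases Finset.mem_insert.1 hb with rfl | hb
      · rcases Finset.mem_insert.1 ha with rfl | ha
        · exact absurd hab (lt_irrefl _)
        · exact absurd hab (hS a ha).1.not_gt
      · exact hb
    exact (hφ2 a ha b hbS hab).trans (hφ1 b hb)
  intro a ha b hb hab
  rcases lt_trichotomy a b with h | h | h
  · exact absurd hab (hlt a ha b hb h).ne
  · exact h
  · exact absurd hab (hlt b hb a ha h).ne'

lemma forall_pos_or_forall_neg {f : ℝ → ℝ} {a b : ℝ} (hf : ContinuousOn f (Ioo a b))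
    (h : ∀ x ∈ Ioo a b, f x ≠ 0) : (∀ x ∈ Ioo a b, 0 < f x) ∨ ∀ x ∈ Ioo a b, 0 < -f x := by
  by_contra! hcon
  obtain ⟨⟨x, hx, hfx⟩, y, hy, hfy⟩ := hcon
  obtain ⟨z, hz, hz0⟩ := isPreconnected_Ioo.intermediate_value hx hy hf
    ⟨hfx, by linarith⟩
  exact h z hz hz0

lemma deriv_nonneg_of_pos_right {f : ℝ → ℝ} {a b : ℝ} (hab : a < b) (hf : DifferentiableAt ℝ f a)
    (h0 : f a = 0) (h : ∀ x ∈ Ioo a b, 0 < f x) : 0 ≤ deriv f a := by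
  have ht := (hasDerivWithinAt_iff_tendsto_slope' (s := Ioi a) (by simp)).1
    hf.hasDerivAt.hasDerivWithinAt
  refine ge_of_tendsto ht ?_
  filter_upwards [Ioo_mem_nhdsGT hab] with x hx
  rw [slope_def_field, h0, sub_zero]
  exact div_nonneg (h x hx).le (by linarith [hx.1])

lemma deriv_nonpos_of_pos_left {f : ℝ → ℝ} {a b : ℝ} (hab : a < b) (hf : DifferentiableAt ℝ f b)
    (h0 : f b = 0) (h : ∀ x ∈ Ioo a b, 0 < f x) : deriv f b ≤ 0 := by
  have ht := (hasDerivWithinAt_iff_tendsto_slope' (s := Iio b) (by simp)).1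
    hf.hasDerivAt.hasDerivWithinAt
  refine le_of_tendsto ht ?_
  filter_upwards [Ioo_mem_nhdsLT hab] with x hx
  rw [slope_def_field, h0, sub_zero]
  exact div_nonpos_of_nonneg_of_nonpos (h x hx).le (by linarith [hx.2])

lemma derivWithin_eq_deriv {f : ℝ → ℝ} (hf : ContDiff ℝ 2 f) {x : ℝ} (hx : x ∈ I) :
    derivWithin f I x = deriv f x :=
  (hf.differentiable (by norm_num) x).derivWithin (uniqueDiffOn_I x hx)

/-- The weighted Wronskian would be strictly increasing between nonpositive values. -/
lemma not_forall_pos_of_lt (hα : -1 < α) (hβ : -1 < β) {c₁ c₂ χ₁ χ₂ a b : ℝ} {f g : ℝ → ℝ}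
    (hf : ContDiff ℝ 2 f) (hg : ContDiff ℝ 2 g) (hfe : IsEigenpair c₁ α β χ₁ f)
    (hge : IsEigenpair c₂ α β χ₂ g)
    (hq : ∀ x ∈ Ioo (-1 : ℝ) 1, χ₁ - c₁ ^ 2 * x ^ 2 < χ₂ - c₂ ^ 2 * x ^ 2) (hab : a < b)
    (ha : a ∈ I) (hb : b ∈ I) (hfa : a = -1 ∨ f a = 0) (hfb : b = 1 ∨ f b = 0)
    (hfpos : ∀ x ∈ Ioo a b, 0 < f x) (hgpos : ∀ x ∈ Ioo a b, 0 < g x) : False := by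
  have hsub : Ioo a b ⊆ Ioo (-1) 1 := Ioo_subset_Ioo ha.1 hb.2
  have hgcl : ∀ x ∈ Icc a b, 0 ≤ g x := fun x hx => by
    have hmem : x ∈ closure (Ioo a b) := by rwa [closure_Ioo hab.ne]
    exact closure_minimal (fun y hy => (hgpos y hy).le)
      (isClosed_le continuous_const hg.continuous) hmem
  have hmono : StrictMonoOn (wronskian α β f g) (Icc a b) := by
    refine strictMonoOn_of_deriv_pos (convex_Icc a b)
      ((continuousOn_wronskian hα hβ hf.contDiffOn hg.contDiffOn).mono
        (Icc_subset_Icc ha.1 hb.2)) fun x hx => ?_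
    rw [interior_Icc] at hx
    have hxI := Ioo_subset_I (hsub hx)
    rw [(hasDerivAt_wronskian c₁ c₂ hf.contDiffOn hg.contDiffOn (hsub hx)).deriv]
    have e1 := hfe.eigen x hxI
    have e2 := hge.eigen x hxI
    have e3 : op c₁ α β f x * g x - f x * op c₂ α β g x + (c₁ ^ 2 - c₂ ^ 2) * x ^ 2 * f x * g x
        = ((χ₂ - c₂ ^ 2 * x ^ 2) - (χ₁ - c₁ ^ 2 * x ^ 2)) * (f x * g x) := by
      linear_combination (-g x) * e1 + f x * e2
    rw [e3]
    exact mul_pos (weight_pos (hsub hx)) (mul_pos (sub_pos.2 (hq x (hsub hx)))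
      (mul_pos (hfpos x hx) (hgpos x hx)))
  have hlt := hmono (left_mem_Icc.2 hab.le) (right_mem_Icc.2 hab.le) hab
  have hWa : 0 ≤ wronskian α β f g a := by
    rcases hfa with rfl | h0
    · rw [wronskian, weight_add_one_neg_one hβ, zero_mul]
    · rw [wronskian, h0, zero_mul, sub_zero, derivWithin_eq_deriv hf ha]
      exact mul_nonneg (weight_nonneg ha) (mul_nonneg
        (deriv_nonneg_of_pos_right hab (hf.differentiable (by norm_num) a) h0 hfpos)
        (hgcl a (left_mem_Icc.2 hab.le)))
  have hWb : wronskian α β f g b ≤ 0 := by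
    rcases hfb with rfl | h0
    · rw [wronskian, weight_add_one_one hα, zero_mul]
    · rw [wronskian, h0, zero_mul, sub_zero, derivWithin_eq_deriv hf hb]
      exact mul_nonpos_of_nonneg_of_nonpos (weight_nonneg hb) (mul_nonpos_of_nonpos_of_nonneg
        (deriv_nonpos_of_pos_left hab (hf.differentiable (by norm_num) b) h0 hfpos)
        (hgcl b (right_mem_Icc.2 hab.le)))
  linarith

/-- Sturm's comparison theorem; an endpoint of `I` plays the role of a zero. -/
lemma exists_zero_of_lt (hα : -1 < α) (hβ : -1 < β) {c₁ c₂ χ₁ χ₂ a b : ℝ} {f g : ℝ → ℝ}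
    (hf : AnalyticOnNhd ℝ f univ) (hg : AnalyticOnNhd ℝ g univ) (hfe : IsEigenpair c₁ α β χ₁ f)
    (hge : IsEigenpair c₂ α β χ₂ g)
    (hq : ∀ x ∈ Ioo (-1 : ℝ) 1, χ₁ - c₁ ^ 2 * x ^ 2 < χ₂ - c₂ ^ 2 * x ^ 2) (hab : a < b)
    (ha : a ∈ I) (hb : b ∈ I) (hfa : a = -1 ∨ f a = 0) (hfb : b = 1 ∨ f b = 0)
    (hfne : ∀ x ∈ Ioo a b, f x ≠ 0) : ∃ z ∈ Ioo a b, g z = 0 := by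
  by_contra! hgne
  have hsign : ∀ {c χ : ℝ} {u : ℝ → ℝ}, AnalyticOnNhd ℝ u univ → IsEigenpair c α β χ u →
      (∀ x ∈ Ioo a b, u x ≠ 0) → ∃ s : ℝ, s ≠ 0 ∧ ContDiff ℝ 2 (fun x => s * u x) ∧
        IsEigenpair c α β χ (fun x => s * u x) ∧ ∀ x ∈ Ioo a b, 0 < s * u x := by
    intro c χ u hu hue hne
    have hcd := contDiff_of_analytic hu
    rcases forall_pos_or_forall_neg hcd.continuous.continuousOn hne with h | h
    · exact ⟨1, one_ne_zero, contDiff_const.mul hcd, hue.const_mul hu one_ne_zero,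
        fun x hx => by rw [one_mul]; exact h x hx⟩
    · have h1 : (-1 : ℝ) ≠ 0 := by norm_num
      exact ⟨-1, h1, contDiff_const.mul hcd, hue.const_mul hu h1,
        fun x hx => by rw [neg_one_mul]; exact h x hx⟩
  obtain ⟨s, hs, hs1, hs2, hs3⟩ := hsign hf hfe hfne
  obtain ⟨t, ht, ht1, ht2, ht3⟩ := hsign hg hge hgne
  exact not_forall_pos_of_lt hα hβ hs1 ht1 hs2 ht2 hq hab ha hb
    (hfa.imp_right fun h => by rw [h, mul_zero]) (hfb.imp_right fun h => by rw [h, mul_zero])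
    hs3 ht3

lemma finite_zeros {ψ : ℝ → ℝ} {χ : ℝ} (hψ : AnalyticOnNhd ℝ ψ univ)
    (hψe : IsEigenpair c α β χ ψ) : {x | x ∈ Ioo (-1 : ℝ) 1 ∧ ψ x = 0}.Finite := by
  by_contra hinf
  obtain ⟨x, -, hx⟩ := Set.Infinite.exists_accPt_of_subset_isCompact hinf isCompact_I
    fun y hy => Ioo_subset_I hy.1
  have hfreq : ∃ᶠ z in 𝓝[≠] x, ψ z = 0 := (accPt_iff_frequently_nhdsNE.1 hx).mono fun y hy => hy.2
  obtain ⟨y, -, hy⟩ := hψe.ne_zero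
  exact hy (hψ.eqOn_zero_of_preconnected_of_frequently_eq_zero isPreconnected_univ (mem_univ x)
    hfreq (mem_univ y))

/-- The number of zeros of a function in the open interval `(-1, 1)`. -/
noncomputable def zeroCount (ψ : ℝ → ℝ) : ℕ := {x | x ∈ Ioo (-1 : ℝ) 1 ∧ ψ x = 0}.ncard

lemma zeroCount_lt_zeroCount (hα : -1 < α) (hβ : -1 < β) {c₁ c₂ χ₁ χ₂ : ℝ} {f g : ℝ → ℝ}
    (hf : AnalyticOnNhd ℝ f univ) (hg : AnalyticOnNhd ℝ g univ) (hfe : IsEigenpair c₁ α β χ₁ f)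
    (hge : IsEigenpair c₂ α β χ₂ g)
    (hq : ∀ x ∈ Ioo (-1 : ℝ) 1, χ₁ - c₁ ^ 2 * x ^ 2 < χ₂ - c₂ ^ 2 * x ^ 2) :
    zeroCount f < zeroCount g := by
  have hff := finite_zeros hf hfe
  have hgf := finite_zeros hg hge
  rw [zeroCount, zeroCount, ncard_eq_toFinset_card _ hff, ncard_eq_toFinset_card _ hgf]
  have h1 : (1 : ℝ) ∈ I := ⟨by norm_num, le_rfl⟩
  have h2 : (-1 : ℝ) ∈ I := ⟨le_rfl, by norm_num⟩
  refine card_lt_card_of_interlacing (lo := -1) (hi := 1) (by norm_num)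
    (fun s hs => ((hff.mem_toFinset).1 hs).1) fun a ha b hb hab hgap => ?_
  have haI : a ∈ I ∧ (a = -1 ∨ f a = 0) := by
    rcases Finset.mem_insert.1 ha with rfl | ha
    · exact ⟨h2, Or.inl rfl⟩
    · exact ⟨Ioo_subset_I ((hff.mem_toFinset).1 ha).1, Or.inr ((hff.mem_toFinset).1 ha).2⟩
  have hbI : b ∈ I ∧ (b = 1 ∨ f b = 0) := by
    rcases Finset.mem_insert.1 hb with rfl | hb
    · exact ⟨h1, Or.inl rfl⟩
    · exact ⟨Ioo_subset_I ((hff.mem_toFinset).1 hb).1, Or.inr ((hff.mem_toFinset).1 hb).2⟩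
  have hsub : Ioo a b ⊆ Ioo (-1) 1 := Ioo_subset_Ioo haI.1.1 hbI.1.2
  obtain ⟨z, hz, hgz⟩ := exists_zero_of_lt hα hβ hf hg hfe hge hq hab haI.1 hbI.1 haI.2 hbI.2
    fun x hx h0 => hgap x ((hff.mem_toFinset).2 ⟨hsub hx, h0⟩) hx
  exact ⟨z, (hgf.mem_toFinset).2 ⟨hsub hz, hgz⟩, hz⟩

lemma zeroCount_jacobiFun_le (hα : -1 < α) (hβ : -1 < β) (n : ℕ) :
    zeroCount (jacobiFun α β n) ≤ n := by
  have hne : jacobiPoly α β n ≠ 0 := (jacobiSequence hα hβ).ne_zero n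
  have hsub : {x | x ∈ Ioo (-1 : ℝ) 1 ∧ jacobiFun α β n x = 0}
      ⊆ ((jacobiPoly α β n).roots.toFinset : Set ℝ) := fun x hx => by
    rw [Finset.mem_coe, Multiset.mem_toFinset, Polynomial.mem_roots hne, Polynomial.IsRoot,
      jacobiPoly_eq_smul_jacobiFun hα hβ, hx.2, mul_zero]
  calc zeroCount (jacobiFun α β n) ≤ ((jacobiPoly α β n).roots.toFinset : Set ℝ).ncard :=
        ncard_le_ncard hsub (Finset.finite_toSet _)
    _ = (jacobiPoly α β n).roots.toFinset.card := ncard_coe_finset _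
    _ ≤ (jacobiPoly α β n).roots.card := Multiset.toFinset_card_le _
    _ ≤ (jacobiPoly α β n).natDegree := Polynomial.card_roots' _
    _ = n := Polynomial.natDegree_eq_of_degree_eq_some (degree_jacobiPoly hα hβ n)

lemma analyticOnNhd_jacobiFun (n : ℕ) : AnalyticOnNhd ℝ (jacobiFun α β n) univ := fun x _ =>
  analyticAt_const.mul (by
    simpa only [← Polynomial.coe_aeval_eq_eval, id] using
      (AnalyticAt.aeval_polynomial analyticAt_id (jacobiPoly α β n)))

/-- The `n`-th eigenfunction has `n` zeros in `(-1, 1)`. By Sturm's theorem the number of zeros is at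
least `n`, and its excess over `n` is nondecreasing in `n`; comparison with a Jacobi polynomial of
degree `n + 1` shows that it is not positive for large `n`. -/
theorem IsNthEigenfunction.zeroCount_eq (hα : -1 < α) (hβ : -1 < β) {n : ℕ} {χ : ℝ} {f : ℝ → ℝ}
    (hf : IsNthEigenfunction c α β n χ f) : zeroCount f = n := by
  choose χs ψ hψ using fun n => exists_isNthEigenfunction c hα hβ n
  have hN : ∀ n, IsNthEigenfunction c α β n (χs n) (ψ n) := fun n => (hψ n).1
  have hstep : ∀ n, zeroCount (ψ n) < zeroCount (ψ (n + 1)) := fun n =>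
    zeroCount_lt_zeroCount hα hβ (hψ n).2.2 (hψ (n + 1)).2.2 (hN n).eigenpair (hN (n + 1)).eigenpair
      fun x _ => by linarith [(hN n).eigenvalue_lt (hN (n + 1)) n.lt_succ_self]
  have hlow : ∀ n, n ≤ zeroCount (ψ n) := fun n => by
    induction n with
    | zero => exact Nat.zero_le _
    | succ n ih => exact Nat.succ_le_of_lt (ih.trans_lt (hstep n))
  have hadd : ∀ n k, zeroCount (ψ n) + k ≤ zeroCount (ψ (n + k)) := fun n k => by
    induction k with
    | zero => exact le_rfl
    | succ k ih => exact Nat.succ_le_of_lt (ih.trans_lt (hstep (n + k)))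
  obtain ⟨N, hNc⟩ := exists_nat_gt (c ^ 2)
  have hlarge : zeroCount (ψ (n + (N + 1))) ≤ n + (N + 1) := by
    refine Nat.le_of_lt_succ (lt_of_lt_of_le ?_ (zeroCount_jacobiFun_le hα hβ (n + (N + 1) + 1)))
    refine zeroCount_lt_zeroCount hα hβ (hψ _).2.2 (analyticOnNhd_jacobiFun _) (hN _).eigenpair
      (isEigenpair_jacobiFun hα hβ _) fun x _ => ?_
    have h1 := (hN (n + (N + 1))).eigenvalue_le hα hβ
    have h2 := jacobiEigenvalue_add_one_sub (α := α) (β := β) (n + (N + 1))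
    have h3 : (0 : ℝ) ≤ n := n.cast_nonneg
    have h4 : (0 : ℝ) ≤ N := N.cast_nonneg
    push_cast at h2
    nlinarith [mul_nonneg (sq_nonneg c) (sq_nonneg x)]
  have hψn : zeroCount (ψ n) = n := le_antisymm (by have := hadd n (N + 1); omega) (hlow n)
  have heq := hf.eigenvalue_eq (hN n)
  subst heq
  obtain ⟨t, ht, hft⟩ := hf.eigenpair.exists_eq_mul hα hβ (hN n).eigenpair
  rw [← hψn, zeroCount, zeroCount]
  congr 1
  ext x
  simp only [mem_ofPred_eq]
  refine and_congr_right fun hx => ?_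
  rw [hft x (Ioo_subset_I hx), mul_eq_zero, or_iff_right ht]

/-- A function whose zeros in `I` are simple changes its sign at each of them: divide the zeros
out one by one. -/
lemma mul_neg_one_pow_card_pos (S : Finset ℝ) : ∀ {f : ℝ → ℝ}, ContinuousOn f I →
    (∀ z ∈ S, z ∈ Ioo (-1 : ℝ) 1 ∧ f z = 0 ∧ DifferentiableAt ℝ f z ∧ deriv f z ≠ 0) →
    (∀ x ∈ I, f x = 0 → x ∈ S) → 0 < f 1 * f (-1) * (-1) ^ S.card := by
  have h1 : (1 : ℝ) ∈ I := ⟨by norm_num, le_rfl⟩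
  have h2 : (-1 : ℝ) ∈ I := ⟨le_rfl, by norm_num⟩
  induction S using Finset.induction_on with
  | empty =>
    intro f hf _ hz
    by_contra! hle
    simp only [Finset.card_empty, pow_zero, mul_one] at hle
    have hpre : IsPreconnected I := isPreconnected_Icc
    obtain ⟨x, hx, hx0⟩ : ∃ x ∈ I, f x = 0 := by
      rcases mul_nonpos_iff.1 hle with h | h
      · exact hpre.intermediate_value h2 h1 hf ⟨h.2, h.1⟩
      · exact hpre.intermediate_value h1 h2 hf ⟨h.1, h.2⟩
    exact absurd (hz x hx hx0) (Finset.notMem_empty x)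
  | insert z S hzS ih =>
    intro f hf hS hz
    obtain ⟨hzI, hfz, hdz, hdz'⟩ := hS z (Finset.mem_insert_self z S)
    have hval : ∀ x, (x - z) * dslope f z x = f x := fun x => by
      have := sub_smul_dslope f z x
      rwa [smul_eq_mul, hfz, sub_zero] at this
    have key := ih (f := dslope f z)
      ((continuousOn_dslope (Icc_mem_nhds hzI.1 hzI.2)).2 ⟨hf, hdz⟩) (fun w hw => ?_)
      (fun x hx hx0 => ?_)
    · have e1 := hval 1
      have e2 := hval (-1)
      rw [← e1, ← e2, Finset.card_insert_of_notMem hzS, pow_succ]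
      have h3 : 0 < (1 - z) * (1 + z) := mul_pos (by linarith [hzI.2]) (by linarith [hzI.1])
      have := mul_pos h3 key
      linarith
    · obtain ⟨hwI, hfw, hdw, hdw'⟩ := hS w (Finset.mem_insert_of_mem hw)
      have hwz : w ≠ z := fun h => hzS (h ▸ hw)
      have hwz' : w - z ≠ 0 := sub_ne_zero.2 hwz
      have hdd : DifferentiableAt ℝ (dslope f z) w := (differentiableAt_dslope_of_ne hwz).2 hdw
      refine ⟨hwI, ?_, hdd, fun h0 => hdw' ?_⟩
      · have := hval w
        rw [hfw] at this
        exact (mul_eq_zero.1 this).resolve_left hwz'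
      · have e1 : deriv f w = deriv (fun x => (x - z) * dslope f z x) w := by
          simp only [hval]
        have e2 : dslope f z w = 0 := by
          have := hval w
          rw [hfw] at this
          exact (mul_eq_zero.1 this).resolve_left hwz'
        rw [e1, deriv_fun_mul (by fun_prop) hdd, h0, e2]
        ring
    · have hfx : f x = 0 := by rw [← hval x, hx0, mul_zero]
      refine (Finset.mem_insert.1 (hz x hx hfx)).resolve_left ?_
      rintro rfl
      rw [dslope_same] at hx0
      exact hdz' hx0

/-- The values of the `n`-th eigenfunction at the endpoints differ in sign by `(-1)ⁿ`. -/
theorem IsNthEigenfunction.mul_neg_one_pow_pos (hα : -1 < α) (hβ : -1 < β) {n : ℕ} {χ : ℝ}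
    {f : ℝ → ℝ} (hf : IsNthEigenfunction c α β n χ f) : 0 < f 1 * f (-1) * (-1) ^ n := by
  have h1 : (1 : ℝ) ∈ I := ⟨by norm_num, le_rfl⟩
  have h2 : (-1 : ℝ) ∈ I := ⟨le_rfl, by norm_num⟩
  obtain ⟨ψ, hψ, hfψ, hψe⟩ := hf.eigenpair.exists_analytic hα hβ
  have hfin := finite_zeros hψ hψe
  have hcard : hfin.toFinset.card = n := by
    rw [← hf.zeroCount_eq hα hβ, zeroCount, ← ncard_eq_toFinset_card _ hfin]
    congr 1
    ext x
    simp only [mem_ofPred_eq]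
    exact and_congr_right fun hx => by rw [hfψ (Ioo_subset_I hx)]
  have := mul_neg_one_pow_card_pos hfin.toFinset (contDiff_of_analytic hψ).continuous.continuousOn
    (fun z hz => by
      rw [hfin.mem_toFinset] at hz
      exact ⟨hz.1, hz.2, (hψ z (mem_univ z)).differentiableAt,
        hψe.deriv_ne_zero hα hβ hψ (Ioo_subset_I hz.1) hz.2⟩)
    (fun x hx hx0 => by
      rw [hfin.mem_toFinset]
      refine ⟨⟨lt_of_le_of_ne hx.1 ?_, lt_of_le_of_ne hx.2 ?_⟩, hx0⟩
      · rintro rfl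
        exact hψe.apply_neg_one_ne_zero hα hβ hx0
      · rintro rfl
        exact hψe.apply_one_ne_zero hα hβ hx0)
  rwa [hcard, ← hfψ h1, ← hfψ h2] at this

end Oscillation

end PerturbedJacobi
namespace PerturbedJacobi

/-! ### Reflection -/

section Reflection

variable {c α β : ℝ}

lemma IsNthEigenfunction.comp_neg {n : ℕ} {χ : ℝ} {f : ℝ → ℝ}
    (hf : IsNthEigenfunction c α β n χ f) : IsNthEigenfunction c β α n χ fun x => f (-x) where
  eigenpair := hf.eigenpair.comp_neg
  index := by simpa only [isEigenvalue_swap_iff (α := β) (β := α)] using hf.index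
  normalized := by
    have := intervalIntegral.integral_comp_neg (a := -1) (b := 1)
      fun x => f x ^ 2 * weight α β x
    simp only [weight_neg, neg_neg] at this
    rw [this, hf.normalized]

lemma IsNthEigenfunction.eqOn_or_eqOn_neg (hα : -1 < α) (hβ : -1 < β) {n : ℕ} {χ χ' : ℝ}
    {f g : ℝ → ℝ} (hf : IsNthEigenfunction c α β n χ f) (hg : IsNthEigenfunction c α β n χ' g) :
    EqOn f g I ∨ EqOn f (-g) I := by
  have heq := hf.eigenvalue_eq hg
  subst heq
  exact hf.eigenpair.eqOn_or_eqOn_neg hα hβ hg.eigenpair hf.integral_mul_self hg.integral_mul_self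

lemma IsNthEigenfunction.apply_neg (hα : -1 < α) (hβ : -1 < β) {n : ℕ} {χ χ' : ℝ} {ψ φ : ℝ → ℝ}
    (hψ : IsNthEigenfunction c α β n χ ψ) (hφ : IsNthEigenfunction c β α n χ' φ) (hψ1 : 0 < ψ 1)
    (hφ1 : 0 < φ 1) : ∀ x ∈ I, ψ (-x) = (-1) ^ n * φ x := by
  have h1 : (1 : ℝ) ∈ I := ⟨by norm_num, le_rfl⟩
  have hsign := hψ.mul_neg_one_pow_pos hα hβ
  rw [mul_assoc] at hsign
  have hs := pos_of_mul_pos_right hsign hψ1.le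
  rcases neg_one_pow_eq_or ℝ n with hn | hn <;> rw [hn] at hs ⊢ <;>
    rcases hψ.comp_neg.eqOn_or_eqOn_neg hβ hα hφ with h | h
  · intro x hx
    rw [one_mul]
    exact h hx
  · have := h h1
    simp only [Pi.neg_apply] at this
    linarith
  · have : ψ (-1) = φ 1 := h h1
    linarith
  · intro x hx
    rw [neg_one_mul]
    exact h hx

end Reflection

end PerturbedJacobi

theorem mainTheorem9 (𝕜 : Type*) [RCLike 𝕜] (c α β : ℝ) (hc : 0 < c) (hα : -1 < α) (hβ : -1 < β) :
    -- the `n`-th normalized eigenfunction exists, is unique up to sign on `I`, does not vanish at `1`,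
    -- and extends analytically to the real line
    (∀ n : ℕ, ∃ (χ : ℝ) (ψ : ℝ → ℝ),
      PerturbedJacobi.IsNthEigenfunction c α β n χ ψ ∧ 0 < ψ 1 ∧ AnalyticOnNhd ℝ ψ Set.univ ∧
      ∀ (χ' : ℝ) (φ : ℝ → ℝ), PerturbedJacobi.IsNthEigenfunction c α β n χ' φ →
        χ' = χ ∧ (Set.EqOn φ ψ PerturbedJacobi.I ∨ Set.EqOn φ (-ψ) PerturbedJacobi.I)) ∧
    -- the eigenfunctions form an orthonormal basis
    (∀ (χ : ℕ → ℝ) (ψ : ℕ → ℝ → ℝ),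
      (∀ n, PerturbedJacobi.IsNthEigenfunction c α β n (χ n) (ψ n)) →
      ∃ b : HilbertBasis ℕ 𝕜 (MeasureTheory.Lp 𝕜 2 (PerturbedJacobi.weightMeasure α β)),
        ∀ n, (b n : ℝ → 𝕜) =ᵐ[PerturbedJacobi.weightMeasure α β] fun x => (ψ n x : 𝕜)) ∧
    -- same eigenvalue, and the reflection rule on `I` and, for the analytic extensions, on `ℝ`
    (∀ (n : ℕ) (χ χ' : ℝ) (ψ φ : ℝ → ℝ),
      PerturbedJacobi.IsNthEigenfunction c α β n χ ψ →
      PerturbedJacobi.IsNthEigenfunction c β α n χ' φ →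
      χ = χ' ∧
      (0 < ψ 1 → 0 < φ 1 →
        (∀ x ∈ PerturbedJacobi.I, ψ (-x) = (-1) ^ n * φ x) ∧
        (AnalyticOnNhd ℝ ψ Set.univ → AnalyticOnNhd ℝ φ Set.univ →
          ∀ x : ℝ, ψ (-x) = (-1) ^ n * φ x))) := by
  refine ⟨fun n => ?_, fun χ ψ h => ?_, fun n χ χ' ψ φ hψ hφ => ⟨?_, fun hψ1 hφ1 => ?_⟩⟩
  · obtain ⟨χ, ψ, hN, h1, hψ⟩ := PerturbedJacobi.exists_isNthEigenfunction c hα hβ n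
    exact ⟨χ, ψ, hN, h1, hψ, fun χ' φ hφ => ⟨hφ.eigenvalue_eq hN, hφ.eqOn_or_eqOn_neg hα hβ hN⟩⟩
  · exact PerturbedJacobi.exists_hilbertBasis_eigenfunction 𝕜 hα hβ h
  · exact hψ.comp_neg.eigenvalue_eq hφ
  · have hI := hψ.apply_neg hα hβ hφ hψ1 hφ1
    refine ⟨hI, fun hψa hφa x => ?_⟩
    -- two analytic functions that agree on `I` agree on the real line
    have hl : AnalyticOnNhd ℝ (fun x => ψ (-x)) Set.univ := fun x _ =>
      (hψa (-x) (Set.mem_univ _)).comp (f := fun x => -x) analyticAt_id.neg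
    have hr : AnalyticOnNhd ℝ (fun x => (-1) ^ n * φ x) Set.univ := fun x _ =>
      analyticAt_const.mul (hφa x (Set.mem_univ _))
    refine hl.eqOn_of_preconnected_of_eventuallyEq hr isPreconnected_univ (Set.mem_univ (0 : ℝ)) ?_
      (Set.mem_univ x)
    filter_upwards [Icc_mem_nhds (show (-1 : ℝ) < 0 by norm_num) zero_lt_one] with y hy
    exact hI y hy
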